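/- Let $n\ge 1$ and let $w:\mathbb R^n\to[0,\infty)$ be such that $\Sigma:=\{w>0\}$ is nonempty, open and convex and $w$ is $C^2$ on $\Sigma$. Assume that there is a constant $K>-1$ with $$-\nabla^2(\log w)(x)\ \ge\ K\,\mathbb I\qquad\text{for all }x\in\Sigma, \tag{$\star$}$$ and let $K_w$ be the largest $K$ for which this inequality holds. Put $$d\mu_w=\frac{w(x)e^{-|x|^2/2}\,dx}{\int_\Sigma w(y)e^{-|y|^2/2}\,dy}\quad\text{on }\Sigma,\qquad \mathrm{Ent}_{\mu_w}(h)=\int_\Sigma h\log h\,d\mu_w-\Big(\int_\Sigma h\,d\mu_w\Big)\log\Big(\int_\Sigma h\,d\mu_w\Big)$$ (with $0\log 0=0$). Let $A$ be the set of restrictions to $\overline\Sigma$ of functions $u\in C_c^\infty(\mathbb R^n)$ with $\nabla u\cdot\eta=0$ at every point of $\partial\Sigma$, for every outer unit normal vector $\eta$ of the convex set $\Sigma$ at that point, and let $W^{1,2}_A=W^{1,2}_A(\Sigma,\mu_w)$ be the completion of $A$ for the norm $\big(\int_\Sigma|u|^2d\mu_w\big)^{1/2}+\big(\int_\Sigma|\nabla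 u|^2d\mu_w\big)^{1/2}$. Then $\mu_w$ is a well-defined probability measure, and the following holds. 1. For every $f\in W^{1,2}_A$ the function $f^2\log f^2$ is $\mu_w$-integrable and $$\mathrm{Ent}_{\mu_w}(f^2)\ \le\ \frac{2}{1+K_w}\int_\Sigma|\nabla f|^2\,d\mu_w .$$ 2. Suppose that $w$ is partial, i.e. for some index $i$ it does not depend on the coordinate $x_i\in\mathbb R$. Then $K_w\le 0$, and for every $b\in\mathbb R$ the function $f(x)=e^{bx_i}$ satisfies $$\mathrm{Ent}_{\mu_w}(f^2)=2\int_\Sigma|\nabla f|^2\,d\mu_w,$$ where both sides are positive if $b\ne0$. In particular, if $K_w=0$ (equivalently, if $w$ is moreover log-concave), then equality holds in the inequality of part 1 for all these $f$. Moreover, these $f$ belong to $W^{1,2}_A$ as soon as the constant function $1$ does. 3. If $\Sigma$ is a cone with vertex at the origin (for instance $\Sigma=\mathbb R^n$), or if $\Sigma$ has smooth boundary, then the constant function $1$ belongs to $W^{1,2}_A$; so in these cases the functions $e^{bx_i}$ of part 2 belong to $W^{1,2}_A$. -/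

import Mathlib

open MeasureTheory Filter Topology
open scoped ContDiff RealInnerProductSpace

noncomputable section

namespace WeightedGaussian

/-- `ℝⁿ` with its Euclidean norm. -/
abbrev E (n : ℕ) := EuclideanSpace ℝ (Fin n)

/-- The set `Σ = {w > 0}`. -/
def posSet {n : ℕ} (w : E n → ℝ) : Set (E n) := {x | 0 < w x}

/-- `-∇²(log w)(x) ≥ K · I` for all `x ∈ Σ`, as an inequality of quadratic forms. -/
def HessBound {n : ℕ} (w : E n → ℝ) (K : ℝ) : Prop :=
  ∀ x ∈ posSet w, ∀ v : E n,
    K * ‖v‖ ^ 2 ≤ -(fderiv ℝ (fderiv ℝ (fun y => Real.log (w y))) x v v)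

/-- `K_w`, the largest constant `K` for which `HessBound w K` holds
(see `isGreatest_Kw`). -/
def Kw {n : ℕ} (w : E n → ℝ) : ℝ := sSup {K : ℝ | HessBound w K}

/-- `K_w` is a maximum as soon as some bound holds. -/
theorem isGreatest_Kw {n : ℕ} (hn : 0 < n) (w : E n → ℝ) (hne : (posSet w).Nonempty)
    (h : ∃ K, HessBound w K) : IsGreatest {K : ℝ | HessBound w K} (Kw w) := by
  have key : ∀ K, HessBound w K → ∀ x ∈ posSet w, ∀ v : E n, v ≠ 0 →
      K ≤ -(fderiv ℝ (fderiv ℝ (fun y => Real.log (w y))) x v v) / ‖v‖ ^ 2 := by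
    intro K hK x hx v hv
    rw [le_div_iff₀ (by positivity)]
    exact hK x hx v
  have hbdd : BddAbove {K : ℝ | HessBound w K} := by
    obtain ⟨x, hx⟩ := hne
    refine ⟨_, fun K hK => key K hK x hx (EuclideanSpace.single ⟨0, hn⟩ 1) ?_⟩
    simp
  refine ⟨fun x hx v => ?_, fun K hK => le_csSup hbdd hK⟩
  by_cases hv : v = 0
  · subst hv; simp
  · rw [← le_div_iff₀ (by positivity)]
    exact csSup_le h fun K hK => key K hK x hx v hv

/-- The density `w(x) e^{-|x|²/2}` restricted to `Σ`, as an unnormalized measure. -/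
def preMeasure {n : ℕ} (w : E n → ℝ) : Measure (E n) :=
  (volume.restrict (posSet w)).withDensity
    fun x => ENNReal.ofReal (w x * Real.exp (-‖x‖ ^ 2 / 2))

/-- The weighted Gaussian measure `μ_w`: `preMeasure w` divided by its total mass. -/
def muW {n : ℕ} (w : E n → ℝ) : Measure (E n) :=
  (preMeasure w Set.univ)⁻¹ • preMeasure w

/-- `η` is an outer unit normal vector at the point `x` of the boundary of the convex set `S`. At
a point where the boundary is differentiable there is exactly one. -/
def IsOuterNormal {n : ℕ} (S : Set (E n)) (x η : E n) : Prop :=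
  ‖η‖ = 1 ∧ ∀ y ∈ S, ⟪η, y - x⟫ ≤ 0

/-- The class `A` of (restrictions to `closure S` of) smooth compactly supported functions `u`
with `∇u · η = 0` on the boundary of `S`. -/
def classA {n : ℕ} (S : Set (E n)) : Set (E n → ℝ) :=
  {u | ContDiff ℝ ∞ u ∧ HasCompactSupport u ∧
    ∀ x ∈ frontier S, ∀ η, IsOuterNormal S x η → ⟪gradient u x, η⟫ = 0}

/-- `f` belongs to `W^{1,2}_A(Σ, μ_w)`, the completion of `A` for the norm
`‖u‖_{L²(μ_w)} + ‖∇u‖_{L²(μ_w)}`, and `g` is its gradient: the pair `(f, g)` is the limit in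
`L² × L²` of pairs `(u k, ∇ (u k))` with `u k ∈ A`. -/
structure MemSobolevA {n : ℕ} (w : E n → ℝ) (f : E n → ℝ) (g : E n → E n) : Prop where
  memLp_fun : MemLp f 2 (muW w)
  memLp_grad : MemLp g 2 (muW w)
  approx : ∃ u : ℕ → E n → ℝ, (∀ k, u k ∈ classA (posSet w)) ∧
    Tendsto (fun k => eLpNorm (fun x => u k x - f x) 2 (muW w)) atTop (𝓝 0) ∧
    Tendsto (fun k => eLpNorm (fun x => gradient (u k) x - g x) 2 (muW w)) atTop (𝓝 0)

/-- The entropy `∫ h log h dμ - (∫ h dμ) log (∫ h dμ)` (with `0 log 0 = 0`). -/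
def Ent {n : ℕ} (μ : Measure (E n)) (h : E n → ℝ) : ℝ :=
  ∫ x, h x * Real.log (h x) ∂μ - (∫ x, h x ∂μ) * Real.log (∫ x, h x ∂μ)

/-- `w` is independent of the `i`-th coordinate on `ℝⁿ`. -/
def IndepOfCoord {n : ℕ} (w : E n → ℝ) (i : Fin n) : Prop :=
  ∀ (x : E n) (t : ℝ), w (x + t • EuclideanSpace.single i (1 : ℝ)) = w x

/-- `S` is a cone with vertex at the origin. -/
def IsCone {n : ℕ} (S : Set (E n)) : Prop :=
  ∀ t : ℝ, 0 < t → ∀ x ∈ S, t • x ∈ S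

/-- The open set `S` has smooth boundary: near each boundary point it is the sublevel set
`{ρ < 0}` of a smooth function with nonvanishing gradient at that point. -/
def HasSmoothBoundary {n : ℕ} (S : Set (E n)) : Prop :=
  ∀ x ∈ frontier S, ∃ ρ : E n → ℝ, ContDiff ℝ ∞ ρ ∧ gradient ρ x ≠ 0 ∧
    ∀ᶠ y in 𝓝 x, (y ∈ S ↔ ρ y < 0)

end WeightedGaussian

end

open WeightedGaussian

/-!
The measure `μ_w` has density `exp (-V)` on `Σ` up to a constant, with
`V = |x|² / 2 - log w` and `∇² V ≥ 1 + K_w > 0`: it is uniformly log-concave on a convex domain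
(`IsAdmissible.log_dens_combo`), has a Gaussian upper bound, and so has finite mass.

The logarithmic Sobolev inequality is obtained from the Prékopa–Leindler inequality by the
argument of Bobkov and Ledoux. With weights `1 / (1 + δ)` and `δ / (1 + δ)`, the inequality is
applied to `exp ((1 + δ) g - V)`, `exp (-V)` and `exp (g + δ κ |∇g|² - V)`, where
`κ > 1 / (2 (1 + K))` and `δ` is small (`IsAdmissible.lintegral_rpow_le`); strong convexity of `V`
absorbs the Taylor remainder of `g`. Both sides agree at `δ = 0`, and comparison of their
derivatives there gives `Ent (exp g) ≤ κ ∫ |∇g|² exp g`. Taking `g = log (u² + ε)` and letting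
`κ → 1 / (2 (1 + K))` and `ε → 0` yields the inequality for every `u` in `C_c^∞`; the Neumann
condition plays no role. Fatou's lemma extends it to the Sobolev space
(`IsAdmissible.entropy_le`).

If `w` does not depend on `x_i`, tilting by `exp (c x_i)` amounts to a translation
(`dens_mul_exp`), so `x_i` has the moment generating function of a standard Gaussian and all the
integrals of the exponentials are explicit. Normals of `Σ` then have no `i`-th component, so
multiplication by functions of `x_i` preserves the class `A`; this transfers membership in the
Sobolev space from `1` to `exp (b x_i)`.

That `1` is a Sobolev function is shown by dilating a cutoff function
(`MemSobolevA.one_of_cutoff`). For a cone a radial cutoff satisfies the Neumann condition, since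
normals are orthogonal to the position vector. For a smooth boundary every test function is a
Sobolev function: a partition of unity reduces this to the neighbourhood of a boundary point,
where the normal derivative is removed by a correction in a thin boundary layer
(`memSobolevA_of_tsupport_subset`).
-/

/-! ### The Prékopa–Leindler inequality -/

namespace PrekopaLeindler

open scoped Pointwise in
lemma volume_image_affine (c r : ℝ) (hr : 0 < r) (A : Set ℝ) :
    volume ((fun x => c + r * x) '' A) = ENNReal.ofReal r * volume A := by
  have : (fun x => c + r * x) '' A = c +ᵥ (r • A) := by
    rw [← Set.image_smul, ← Set.image_vadd, Set.image_image]
    rfl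
  rw [this, measure_vadd, Measure.addHaar_smul]
  simp [abs_of_pos hr]

/-- The Brunn–Minkowski inequality on the line, for compact sets. Translates of `r K` and `s L`
that meet only in one point fit into `r K + s L`. -/
lemma volume_combo_compact {r s : ℝ} (hr : 0 < r) (hs : 0 < s) {K L W : Set ℝ}
    (hK : IsCompact K) (hL : IsCompact L) (hKn : K.Nonempty) (hLn : L.Nonempty)
    (h : ∀ x ∈ K, ∀ y ∈ L, r * x + s * y ∈ W) :
    ENNReal.ofReal r * volume K + ENNReal.ofReal s * volume L ≤ volume W := by
  obtain ⟨k, hkK, hk⟩ := hK.exists_isGreatest hKn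
  obtain ⟨l, hlL, hl⟩ := hL.exists_isLeast hLn
  rw [← volume_image_affine (s * l) r hr, ← volume_image_affine (r * k) s hs, ← measure_union₀]
  · apply measure_mono
    rintro _ (⟨x, hx, rfl⟩ | ⟨y, hy, rfl⟩)
    · simpa [add_comm] using h x hx l hlL
    · exact h k hkK y hy
  · exact ((hL.image (by fun_prop)).measurableSet).nullMeasurableSet
  · refine measure_mono_null (t := {r * k + s * l}) ?_ (measure_singleton _)
    rintro _ ⟨⟨x, hx, rfl⟩, y, hy, hxy⟩
    have h1 := mul_le_mul_of_nonneg_left (hk hx) hr.le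
    have h2 := mul_le_mul_of_nonneg_left (hl hy) hs.le
    simp only at hxy
    simp only [Set.mem_singleton_iff]
    linarith

lemma measure_add_le_of_compact {A : Set ℝ} (hA : MeasurableSet A) {r c d : ENNReal}
    (hne : A.Nonempty)
    (h : ∀ K ⊆ A, IsCompact K → K.Nonempty → r * volume K + c ≤ d) : r * volume A + c ≤ d := by
  obtain ⟨a, ha⟩ := hne
  have hc : c ≤ d := le_trans le_add_self
    (h {a} (by simpa using ha) isCompact_singleton (Set.singleton_nonempty a))
  by_cases hct : c = ⊤
  · rw [hct] at hc ⊢; simpa using hc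
  · have : r * volume A ≤ d - c := by
      rw [hA.measure_eq_iSup_isCompact]
      simp only [ENNReal.mul_iSup]
      refine iSup_le fun K => iSup_le fun hKA => iSup_le fun hK => ?_
      refine ENNReal.le_sub_of_add_le_right hct (le_trans ?_
        (h (K ∪ {a}) (Set.union_subset hKA (by simpa using ha)) (hK.union isCompact_singleton)
          ⟨a, by simp⟩))
      gcongr
      exact Set.subset_union_left
    calc r * volume A + c ≤ (d - c) + c := by gcongr
      _ = d := tsub_add_cancel_of_le hc

/-- The Brunn–Minkowski inequality on the line, for measurable sets. -/
lemma volume_combo {r s : ℝ} (hr : 0 < r) (hs : 0 < s) {A B W : Set ℝ}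
    (hA : MeasurableSet A) (hB : MeasurableSet B) (hAn : A.Nonempty) (hBn : B.Nonempty)
    (h : ∀ x ∈ A, ∀ y ∈ B, r * x + s * y ∈ W) :
    ENNReal.ofReal r * volume A + ENNReal.ofReal s * volume B ≤ volume W := by
  refine measure_add_le_of_compact hA hAn fun K hKA hK hKn => ?_
  rw [add_comm]
  refine measure_add_le_of_compact hB hBn fun L hLB hL hLn => ?_
  rw [add_comm]
  exact volume_combo_compact hr hs hK hL hKn hLn fun x hx y hy => h x (hKA hx) y (hLB hy)

/-- The one-dimensional inequality for functions whose supremum is `1`, with arithmetic means: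
integrate Brunn–Minkowski over the superlevel sets. -/
lemma lintegral_combo_of_sup_one {r s : ℝ} (hr : 0 < r) (hs : 0 < s) {U V W : ℝ → ℝ}
    (hU : Measurable U) (hV : Measurable V) (hW : Measurable W)
    (hU0 : ∀ x, 0 ≤ U x) (hV0 : ∀ x, 0 ≤ V x) (hW0 : ∀ x, 0 ≤ W x)
    (hU1 : ∀ x, U x ≤ 1) (hV1 : ∀ x, V x ≤ 1)
    (hUs : ∀ c < 1, ∃ x, c < U x) (hVs : ∀ c < 1, ∃ x, c < V x)
    (h : ∀ c > 0, ∀ x y, c < U x → c < V y → c < W (r * x + s * y)) :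
    ENNReal.ofReal r * (∫⁻ x, ENNReal.ofReal (U x)) +
      ENNReal.ofReal s * (∫⁻ x, ENNReal.ofReal (V x)) ≤ ∫⁻ x, ENNReal.ofReal (W x) := by
  rw [lintegral_eq_lintegral_meas_lt _ (.of_forall hU0) hU.aemeasurable,
    lintegral_eq_lintegral_meas_lt _ (.of_forall hV0) hV.aemeasurable,
    lintegral_eq_lintegral_meas_lt _ (.of_forall hW0) hW.aemeasurable]
  have hm : ∀ f : ℝ → ℝ, Measurable fun c : ℝ => volume {a | c < f a} := fun f =>
    Antitone.measurable fun c d hcd => measure_mono fun a (ha : d < f a) => hcd.trans_lt ha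
  rw [← lintegral_const_mul _ (hm U), ← lintegral_const_mul _ (hm V),
    ← lintegral_add_left ((hm U).const_mul _)]
  refine setLIntegral_mono (hm W) fun c (hc : 0 < c) => ?_
  rcases lt_or_ge c 1 with hc1 | hc1
  · exact volume_combo hr hs (measurableSet_lt measurable_const hU)
      (measurableSet_lt measurable_const hV) (hUs c hc1) (hVs c hc1)
      fun x hx y hy => h c hc x y hx hy
  · have e1 : {a | c < U a} = ∅ := by
      ext a; simpa using (hU1 a).trans hc1
    have e2 : {a | c < V a} = ∅ := by
      ext a; simpa using (hV1 a).trans hc1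
    simp [e1, e2]

lemma ennreal_geom_le_arith {r s : ℝ} (hr : 0 < r) (hs : 0 < s) (hrs : r + s = 1)
    (a b : ENNReal) : a ^ r * b ^ s ≤ ENNReal.ofReal r * a + ENNReal.ofReal s * b := by
  have hpq : (r⁻¹).HolderConjugate s⁻¹ := by
    constructor <;> simp [*]
  have := ENNReal.young_inequality (a ^ r) (b ^ s) hpq
  rw [← ENNReal.rpow_mul, ← ENNReal.rpow_mul, mul_inv_cancel₀ hr.ne', mul_inv_cancel₀ hs.ne',
    ENNReal.ofReal_inv_of_pos hr, ENNReal.ofReal_inv_of_pos hs] at this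
  simpa [div_eq_mul_inv, mul_comm] using this

/-- The one-dimensional inequality for bounded functions, normalized to have supremum `1`. -/
lemma real_of_bounded {r s : ℝ} (hr : 0 < r) (hs : 0 < s) (hrs : r + s = 1)
    {U V W : ℝ → ENNReal} (hU : Measurable U) (hV : Measurable V) (hW : Measurable W)
    (hUt : ⨆ x, U x ≠ ⊤) (hVt : ⨆ x, V x ≠ ⊤) (hU0 : ⨆ x, U x ≠ 0) (hV0 : ⨆ x, V x ≠ 0)
    (h : ∀ x y, U x ^ r * V y ^ s ≤ W (r * x + s * y)) :
    (∫⁻ x, U x) ^ r * (∫⁻ x, V x) ^ s ≤ ∫⁻ x, W x := by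
  set a := ⨆ x, U x with ha
  set b := ⨆ x, V x with hb
  have hUa : ∀ x, U x ≤ a := le_iSup U
  have hVb : ∀ x, V x ≤ b := le_iSup V
  set d := a ^ r * b ^ s with hd
  have hd0 : d ≠ 0 := by
    simp [hd, hU0, hUt, hV0, hVt]
  have hdt : d ≠ ⊤ := ENNReal.mul_ne_top (ENNReal.rpow_ne_top_of_nonneg hr.le hUt)
    (ENNReal.rpow_ne_top_of_nonneg hs.le hVt)
  have hdiv : ∀ {x c : ENNReal}, x ≤ c → x / c ≤ 1 := fun hx => ENNReal.div_le_of_le_mul (by simpa)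
  have fin : ∀ {x : ENNReal}, x ≤ 1 → x ≠ ⊤ := fun hx => (hx.trans_lt ENNReal.one_lt_top).ne
  have sup : ∀ (U : ℝ → ENNReal) (a : ENNReal), (⨆ x, U x) = a → a ≠ 0 → a ≠ ⊤ →
      ∀ c < (1 : ℝ), ∃ x, c < (U x / a).toReal := by
    intro U a ha ha0 hat c hc
    have : ENNReal.ofReal c * a < ⨆ x, U x := by
      rw [ha]
      calc ENNReal.ofReal c * a < 1 * a := by
            rw [ENNReal.mul_lt_mul_iff_left ha0 hat]
            simpa using hc
        _ = a := one_mul a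
    obtain ⟨x, hx⟩ := lt_iSup_iff.1 this
    refine ⟨x, ?_⟩
    have hx' : ENNReal.ofReal c < U x / a := by
      rwa [ENNReal.lt_div_iff_mul_lt (Or.inl ha0) (Or.inl hat)]
    have hUx : U x / a ≠ ⊤ := fin (hdiv (ha ▸ le_iSup U x))
    by_contra hcon
    have := ENNReal.ofReal_le_ofReal (not_lt.1 hcon)
    rw [ENNReal.ofReal_toReal hUx] at this
    exact absurd hx' this.not_gt
  have key := lintegral_combo_of_sup_one hr hs (U := fun x => (U x / a).toReal)
    (V := fun x => (V x / b).toReal) (W := fun x => (min (W x / d) 1).toReal)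
    (by fun_prop) (by fun_prop) (by fun_prop) (fun _ => ENNReal.toReal_nonneg)
    (fun _ => ENNReal.toReal_nonneg) (fun _ => ENNReal.toReal_nonneg)
    (fun x => ENNReal.toReal_le_of_le_ofReal zero_le_one (by simpa using hdiv (hUa x)))
    (fun x => ENNReal.toReal_le_of_le_ofReal zero_le_one (by simpa using hdiv (hVb x)))
    (sup U a rfl hU0 hUt) (sup V b rfl hV0 hVt) ?_
  · simp only [ENNReal.ofReal_toReal (fin (hdiv (hUa _))), ENNReal.ofReal_toReal (fin (hdiv (hVb _))),
      ENNReal.ofReal_toReal (fin (min_le_right _ _))] at key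
    have key2 := (ennreal_geom_le_arith hr hs hrs (∫⁻ x, U x / a) (∫⁻ x, V x / b)).trans
      (key.trans (lintegral_mono fun x => min_le_left _ _))
    simp only [div_eq_mul_inv] at key2
    rw [lintegral_mul_const _ hU, lintegral_mul_const _ hV, lintegral_mul_const _ hW,
      ENNReal.mul_rpow_of_nonneg _ _ hr.le, ENNReal.mul_rpow_of_nonneg _ _ hs.le,
      ENNReal.inv_rpow, ENNReal.inv_rpow, mul_mul_mul_comm, ← ENNReal.mul_inv, ← hd] at key2
    · have := mul_le_mul_left key2 d
      rwa [mul_assoc, ENNReal.inv_mul_cancel hd0 hdt, mul_one, mul_assoc,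
        ENNReal.inv_mul_cancel hd0 hdt, mul_one] at this
    · simp [hU0, hr, hUt]
    · simp [hU0, hr, hUt]
  · intro c hc x y hx hy
    have hx1 := hdiv (hUa x)
    have hy1 := hdiv (hVb y)
    rw [← ENNReal.ofReal_lt_iff_lt_toReal hc.le (fin hx1)] at hx
    rw [← ENNReal.ofReal_lt_iff_lt_toReal hc.le (fin hy1)] at hy
    rw [← ENNReal.ofReal_lt_iff_lt_toReal hc.le (fin (min_le_right _ _)), lt_min_iff]
    refine ⟨?_, hx.trans_le hx1⟩
    have hcc : ENNReal.ofReal c = ENNReal.ofReal c ^ r * ENNReal.ofReal c ^ s := by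
      rw [← ENNReal.rpow_add_of_nonneg _ _ hr.le hs.le, hrs, ENNReal.rpow_one]
    calc ENNReal.ofReal c = ENNReal.ofReal c ^ r * ENNReal.ofReal c ^ s := hcc
      _ < (U x / a) ^ r * (V y / b) ^ s :=
        ENNReal.mul_lt_mul (ENNReal.rpow_lt_rpow hx hr) (ENNReal.rpow_lt_rpow hy hs)
      _ = U x ^ r * V y ^ s / d := by
        simp only [div_eq_mul_inv]
        rw [ENNReal.mul_rpow_of_nonneg _ _ hr.le, ENNReal.mul_rpow_of_nonneg _ _ hs.le,
          ENNReal.inv_rpow, ENNReal.inv_rpow, mul_mul_mul_comm, ← ENNReal.mul_inv, ← hd]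
        · simp [hU0, hr, hUt]
        · simp [hU0, hr, hUt]
      _ ≤ W (r * x + s * y) / d := by gcongr; exact h x y

lemma tendsto_lintegral_min {U : ℝ → ENNReal} (hU : Measurable U) :
    Tendsto (fun k : ℕ => ∫⁻ x, min (U x) k) atTop (𝓝 (∫⁻ x, U x)) := by
  have : ∀ x, ⨆ k : ℕ, min (U x) k = U x := by
    intro x
    rw [← inf_iSup_eq, ENNReal.iSup_natCast]
    simp
  have h2 : ∫⁻ x, U x = ⨆ k : ℕ, ∫⁻ x, min (U x) k := by
    rw [← lintegral_iSup (fun k => by fun_prop)]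
    · simp [this]
    · intro k l hkl x
      dsimp
      gcongr
  rw [h2]
  refine tendsto_atTop_iSup fun k l hkl => lintegral_mono fun x => ?_
  gcongr

/-- The Prékopa–Leindler inequality on the line. -/
lemma real {r s : ℝ} (hr : 0 < r) (hs : 0 < s) (hrs : r + s = 1)
    {U V W : ℝ → ENNReal} (hU : Measurable U) (hV : Measurable V) (hW : Measurable W)
    (h : ∀ x y, U x ^ r * V y ^ s ≤ W (r * x + s * y)) :
    (∫⁻ x, U x) ^ r * (∫⁻ x, V x) ^ s ≤ ∫⁻ x, W x := by
  by_cases hU0 : ∫⁻ x, U x = 0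
  · simp [hU0, hr]
  by_cases hV0 : ∫⁻ x, V x = 0
  · simp [hV0, hs]
  have hlim : Tendsto (fun k : ℕ => (∫⁻ x, min (U x) k) ^ r * (∫⁻ x, min (V x) k) ^ s) atTop
      (𝓝 ((∫⁻ x, U x) ^ r * (∫⁻ x, V x) ^ s)) := by
    refine ENNReal.Tendsto.mul ((tendsto_lintegral_min hU).ennrpow_const r) ?_
      ((tendsto_lintegral_min hV).ennrpow_const s) ?_
    · left; simp [hU0, hr, hr.le]
    · left; simp [hV0, hs, hs.le]
  refine le_of_tendsto hlim (.of_forall fun k => ?_)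
  have sup0 : ∀ f : ℝ → ENNReal, ⨆ x, f x = 0 → ∫⁻ x, f x = 0 := by
    intro f hf
    simp only [ENNReal.iSup_eq_zero] at hf
    simp [hf]
  by_cases hU1 : ⨆ x, min (U x) k = 0
  · simp [sup0 _ hU1, hr]
  by_cases hV1 : ⨆ x, min (V x) k = 0
  · simp [sup0 _ hV1, hs]
  have bd : ∀ f : ℝ → ENNReal, ⨆ x, min (f x) k ≠ ⊤ := fun f =>
    ((iSup_le fun x => min_le_right _ _).trans_lt (ENNReal.natCast_lt_top k)).ne
  refine real_of_bounded hr hs hrs (by fun_prop) (by fun_prop) hW (bd U) (bd V) hU1 hV1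
    fun x y => le_trans ?_ (h x y)
  gcongr <;> exact min_le_left _ _

/-- The Prékopa–Leindler inequality on `ℝⁿ`, by induction on `n` through Fubini's theorem. -/
theorem pi {r s : ℝ} (hr : 0 < r) (hs : 0 < s) (hrs : r + s = 1) (n : ℕ)
    {U V W : (Fin n → ℝ) → ENNReal} (hU : Measurable U) (hV : Measurable V) (hW : Measurable W)
    (h : ∀ x y, U x ^ r * V y ^ s ≤ W (r • x + s • y)) :
    (∫⁻ x, U x) ^ r * (∫⁻ x, V x) ^ s ≤ ∫⁻ x, W x := by
  induction n with
  | zero =>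
    rw [volume_pi, Measure.pi_of_empty _ (0 : Fin 0 → ℝ), lintegral_dirac, lintegral_dirac,
      lintegral_dirac]
    simpa using h 0 0
  | succ n ih =>
    set e := (MeasurableEquiv.piFinSuccAbove (fun _ : Fin (n + 1) => ℝ) 0).symm with he
    have hmp : MeasurePreserving e :=
      (volume_preserving_piFinSuccAbove (fun _ : Fin (n + 1) => ℝ) 0).symm
    have hcombo : ∀ (a b : ℝ) (x y : Fin n → ℝ),
        r • e (a, x) + s • e (b, y) = e (r * a + s * b, r • x + s • y) := by
      intro a b x y
      ext i
      refine Fin.cases ?_ (fun j => ?_) i <;>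
        simp [he, MeasurableEquiv.piFinSuccAbove, Fin.insertNthEquiv]
    have fub : ∀ f : (Fin (n + 1) → ℝ) → ENNReal, Measurable f →
        ∫⁻ x, f x = ∫⁻ a, ∫⁻ x, f (e (a, x)) := by
      intro f hf
      rw [← hmp.lintegral_comp hf, Measure.volume_eq_prod, lintegral_prod _ (by fun_prop)]
    rw [fub U hU, fub V hV, fub W hW]
    refine real hr hs hrs (Measurable.lintegral_prod_right' (f := fun p => U (e p)) (by fun_prop))
      (Measurable.lintegral_prod_right' (f := fun p => V (e p)) (by fun_prop))
      (Measurable.lintegral_prod_right' (f := fun p => W (e p)) (by fun_prop)) fun a b => ?_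
    refine ih (by fun_prop) (by fun_prop) (by fun_prop) fun x y => ?_
    rw [← hcombo]
    exact h _ _

/-- The Prékopa–Leindler inequality on Euclidean space. -/
theorem euclidean {r s : ℝ} (hr : 0 < r) (hs : 0 < s) (hrs : r + s = 1) {n : ℕ}
    {U V W : E n → ENNReal} (hU : Measurable U) (hV : Measurable V) (hW : Measurable W)
    (h : ∀ x y, U x ^ r * V y ^ s ≤ W (r • x + s • y)) :
    (∫⁻ x, U x) ^ r * (∫⁻ x, V x) ^ s ≤ ∫⁻ x, W x := by
  have hmp := PiLp.volume_preserving_toLp (Fin n)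
  rw [← hmp.lintegral_comp hU, ← hmp.lintegral_comp hV, ← hmp.lintegral_comp hW]
  exact pi hr hs hrs n (by fun_prop) (by fun_prop) (by fun_prop) fun x y => h _ _

end PrekopaLeindler

/-! ### Strong log-concavity of the weighted Gaussian density -/

namespace WeightedGaussian

variable {n : ℕ} {w : E n → ℝ}

/-- The standing assumptions on the weight. -/
structure IsAdmissible (w : E n → ℝ) : Prop where
  nonneg : ∀ x, 0 ≤ w x
  nonempty : (posSet w).Nonempty
  isOpen : IsOpen (posSet w)
  convex : Convex ℝ (posSet w)
  contDiffOn : ContDiffOn ℝ 2 w (posSet w)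
  hess : ∃ K : ℝ, -1 < K ∧ HessBound w K

/-- The unnormalized density of `μ_w`. It vanishes off `posSet w`, where `w` does. -/
noncomputable def dens (w : E n → ℝ) (x : E n) : ℝ := w x * Real.exp (-‖x‖ ^ 2 / 2)

namespace IsAdmissible

lemma eq_zero (hw : IsAdmissible w) {x : E n} (hx : x ∉ posSet w) : w x = 0 :=
  le_antisymm (not_lt.1 hx) (hw.nonneg x)

lemma contDiffOn_log (hw : IsAdmissible w) :
    ContDiffOn ℝ 2 (fun y => Real.log (w y)) (posSet w) :=
  hw.contDiffOn.log fun _ hx => ne_of_gt hx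

/-- Along a segment, `-log w` minus the quadratic function allowed by the Hessian bound is
convex. -/
lemma convexOn_segment (hw : IsAdmissible w) {K : ℝ} (hK : HessBound w K) {x y : E n}
    (hx : x ∈ posSet w) (hy : y ∈ posSet w) :
    ConvexOn ℝ (Set.Icc (0 : ℝ) 1)
      fun τ => -Real.log (w (x + τ • (y - x))) - K / 2 * ‖y - x‖ ^ 2 * τ ^ 2 := by
  set v := y - x with hv
  set F : E n → ℝ := fun y => Real.log (w y) with hF
  have hmem : ∀ τ ∈ Set.Icc (0 : ℝ) 1, x + τ • v ∈ posSet w := fun τ hτ =>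
    hw.convex.add_smul_sub_mem hx hy hτ
  have hline : ∀ τ : ℝ, HasDerivAt (fun τ : ℝ => x + τ • v) v τ := fun τ => by
    simpa using ((hasDerivAt_id τ).smul_const v).const_add x
  have hF1 : ∀ z ∈ posSet w, HasFDerivAt F (fderiv ℝ F z) z := fun z hz =>
    ((hw.contDiffOn_log.contDiffAt (hw.isOpen.mem_nhds hz)).differentiableAt
      (by norm_num)).hasFDerivAt
  have hF2 : ∀ z ∈ posSet w, HasFDerivAt (fderiv ℝ F) (fderiv ℝ (fderiv ℝ F) z) z := fun z hz =>
    (((hw.contDiffOn_log.fderiv_of_isOpen (m := 1) hw.isOpen (by norm_num)).contDiffAt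
      (hw.isOpen.mem_nhds hz)).differentiableAt (by norm_num)).hasFDerivAt
  have d1 : ∀ τ ∈ Set.Icc (0 : ℝ) 1, HasDerivAt
      (fun τ : ℝ => -F (x + τ • v) - K / 2 * ‖v‖ ^ 2 * τ ^ 2)
      (-(fderiv ℝ F (x + τ • v) v) - K * ‖v‖ ^ 2 * τ) τ := by
    intro τ hτ
    have h1 := ((hF1 _ (hmem τ hτ)).comp_hasDerivAt τ (hline τ)).neg
    have h2 := ((hasDerivAt_pow 2 τ).const_mul (K / 2 * ‖v‖ ^ 2))
    refine (h1.sub h2).congr_deriv ?_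
    norm_num
    ring
  have d2 : ∀ τ ∈ Set.Icc (0 : ℝ) 1, HasDerivAt
      (fun τ : ℝ => -(fderiv ℝ F (x + τ • v) v) - K * ‖v‖ ^ 2 * τ)
      (-(fderiv ℝ (fderiv ℝ F) (x + τ • v) v v) - K * ‖v‖ ^ 2) τ := by
    intro τ hτ
    have h0 : HasFDerivAt (fun z => fderiv ℝ F z v)
        ((ContinuousLinearMap.apply ℝ ℝ v).comp (fderiv ℝ (fderiv ℝ F) (x + τ • v)))
        (x + τ • v) :=
      (ContinuousLinearMap.apply ℝ ℝ v).hasFDerivAt.comp _ (hF2 _ (hmem τ hτ))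
    have h1 : HasDerivAt (fun τ : ℝ => fderiv ℝ F (x + τ • v) v)
        (fderiv ℝ (fderiv ℝ F) (x + τ • v) v v) τ :=
      (h0.comp_hasDerivAt τ (hline τ) :)
    have h2 := (hasDerivAt_id τ).const_mul (K * ‖v‖ ^ 2)
    rw [mul_one] at h2
    exact h1.neg.sub h2
  refine convexOn_of_hasDerivWithinAt2_nonneg (convex_Icc 0 1)
    (fun τ hτ => (d1 τ hτ).continuousAt.continuousWithinAt)
    (fun τ hτ => (d1 τ (interior_subset hτ)).hasDerivWithinAt)
    (fun τ hτ => (d2 τ (interior_subset hτ)).hasDerivWithinAt) fun τ hτ => ?_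
  have := hK _ (hmem τ (interior_subset hτ)) v
  linarith

lemma log_combo (hw : IsAdmissible w) {K : ℝ} (hK : HessBound w K) {x y : E n}
    (hx : x ∈ posSet w) (hy : y ∈ posSet w) {r s : ℝ} (hr : 0 ≤ r) (hs : 0 ≤ s)
    (hrs : r + s = 1) :
    r * Real.log (w x) + s * Real.log (w y) + K / 2 * (r * s) * ‖x - y‖ ^ 2 ≤
      Real.log (w (r • x + s • y)) := by
  have := (hw.convexOn_segment hK hx hy).2 (x := 0) (y := 1) (by simp) (by simp) hr hs hrs
  have e : x + s • (y - x) = r • x + s • y := by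
    rw [← eq_sub_iff_add_eq] at hrs
    rw [hrs]; module
  simp only [smul_eq_mul, mul_zero, mul_one, zero_add, zero_smul, add_zero, one_smul,
    add_sub_cancel, e] at this
  rw [norm_sub_rev x y]
  have : r * s = s - s ^ 2 := by
    rw [← eq_sub_iff_add_eq] at hrs
    rw [hrs]; ring
  rw [this]
  nlinarith

/-- The tangent bound for the strongly concave function `log w`. -/
lemma log_le_tangent (hw : IsAdmissible w) {K : ℝ} (hK : HessBound w K) {x y : E n}
    (hx : x ∈ posSet w) (hy : y ∈ posSet w) :
    Real.log (w y) ≤ Real.log (w x) + fderiv ℝ (fun y => Real.log (w y)) x (y - x)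
      - K / 2 * ‖y - x‖ ^ 2 := by
  have hline : HasDerivAt (fun τ : ℝ => x + τ • (y - x)) (y - x) 0 := by
    simpa using ((hasDerivAt_id (0 : ℝ)).smul_const (y - x)).const_add x
  have hF1 : HasFDerivAt (fun y => Real.log (w y)) (fderiv ℝ (fun y => Real.log (w y)) x)
      (x + (0 : ℝ) • (y - x)) := by
    simpa using ((hw.contDiffOn_log.contDiffAt (hw.isOpen.mem_nhds hx)).differentiableAt
      (by norm_num)).hasFDerivAt
  have hd := (hF1.comp_hasDerivAt (0 : ℝ) hline).neg.sub
    ((hasDerivAt_pow 2 (0 : ℝ)).const_mul (K / 2 * ‖y - x‖ ^ 2))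
  have := (hw.convexOn_segment hK hx hy).le_slope_of_hasDerivAt (x := 0) (y := 1)
    (by simp) (by simp) one_pos hd
  simp [slope_def_field] at this
  rw [map_sub]
  linarith

lemma dens_nonneg (hw : IsAdmissible w) (x : E n) : 0 ≤ dens w x :=
  mul_nonneg (hw.nonneg x) (Real.exp_pos _).le

lemma dens_pos {x : E n} (hx : x ∈ posSet w) : 0 < dens w x :=
  mul_pos hx (Real.exp_pos _)

lemma dens_eq_zero (hw : IsAdmissible w) {x : E n} (hx : x ∉ posSet w) : dens w x = 0 := by
  simp [dens, hw.eq_zero hx]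

lemma log_dens {x : E n} (hx : x ∈ posSet w) :
    Real.log (dens w x) = Real.log (w x) - ‖x‖ ^ 2 / 2 := by
  rw [dens, Real.log_mul (ne_of_gt hx) (Real.exp_pos _).ne', Real.log_exp]
  ring

/-- `-log` of the density is strongly convex with constant `1 + K`. -/
lemma log_dens_combo (hw : IsAdmissible w) {K : ℝ} (hK : HessBound w K) {x y : E n}
    (hx : x ∈ posSet w) (hy : y ∈ posSet w) {r s : ℝ} (hr : 0 ≤ r) (hs : 0 ≤ s)
    (hrs : r + s = 1) :
    r * Real.log (dens w x) + s * Real.log (dens w y) + (1 + K) / 2 * (r * s) * ‖x - y‖ ^ 2 ≤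
      Real.log (dens w (r • x + s • y)) := by
  rw [log_dens hx, log_dens hy, log_dens (hw.convex hx hy hr hs hrs)]
  have h := hw.log_combo hK hx hy hr hs hrs
  have e : r * ‖x‖ ^ 2 + s * ‖y‖ ^ 2 - r * s * ‖x - y‖ ^ 2 = ‖r • x + s • y‖ ^ 2 := by
    rw [norm_add_sq_real, norm_sub_sq_real, norm_smul, norm_smul, real_inner_smul_left,
      real_inner_smul_right, mul_pow, mul_pow, Real.norm_eq_abs, Real.norm_eq_abs, sq_abs, sq_abs]
    rw [← eq_sub_iff_add_eq] at hrs
    rw [hrs]; ring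
  rw [← e]
  linarith

lemma measurable_weight (hw : IsAdmissible w) : Measurable w := by
  classical
  have : w = (posSet w).piecewise w 0 := by
    ext x
    by_cases hx : x ∈ posSet w
    · simp [hx]
    · simp [hx, hw.eq_zero hx]
  rw [this]
  exact hw.contDiffOn.continuousOn.measurable_piecewise continuousOn_const
    hw.isOpen.measurableSet

lemma measurable_dens (hw : IsAdmissible w) : Measurable (dens w) := by
  have := hw.measurable_weight
  unfold dens
  fun_prop

lemma exists_dens_le (hw : IsAdmissible w) :
    ∃ C b : ℝ, 0 < b ∧ ∀ x, dens w x ≤ C * Real.exp (-b * ‖x‖ ^ 2) := by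
  obtain ⟨K', hK'1, hK'⟩ := hw.hess
  obtain ⟨κ, hκ0, hκ1, hκ⟩ : ∃ κ : ℝ, 0 ≤ κ ∧ κ < 1 ∧ HessBound w (-κ) := by
    refine ⟨max (-K') 0, le_max_right _ _, max_lt (by linarith) one_pos, fun x hx v => ?_⟩
    refine le_trans ?_ (hK' x hx v)
    have := le_max_left (-K') 0
    gcongr
    linarith
  obtain ⟨x₀, hx₀⟩ := hw.nonempty
  set L := ‖fderiv ℝ (fun y => Real.log (w y)) x₀‖
  set c := ‖x₀‖
  set b := (1 - κ) / 4 with hb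
  have hb0 : 0 < b := by rw [hb]; linarith
  set B := L + κ * c
  set A := Real.log (w x₀) + L * c + κ / 2 * c ^ 2
  refine ⟨Real.exp (A + B ^ 2 / (4 * b)), b, hb0, fun x => ?_⟩
  by_cases hx : x ∈ posSet w
  · rw [← Real.exp_log (dens_pos hx), ← Real.exp_add, Real.exp_le_exp, log_dens hx]
    have h1 := hw.log_le_tangent hκ hx₀ hx
    have h2 : fderiv ℝ (fun y => Real.log (w y)) x₀ (x - x₀) ≤ L * ‖x - x₀‖ :=
      by
      refine (le_abs_self _).trans ?_
      rw [← Real.norm_eq_abs]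
      exact ContinuousLinearMap.le_opNorm _ _
    have h3 : ‖x - x₀‖ ≤ ‖x‖ + c := norm_sub_le _ _
    have hL : 0 ≤ L := norm_nonneg _
    have h4 : L * ‖x - x₀‖ ≤ L * (‖x‖ + c) := by gcongr
    have h5 : κ / 2 * ‖x - x₀‖ ^ 2 ≤ κ / 2 * (‖x‖ + c) ^ 2 := by gcongr
    have h6 : B * ‖x‖ ≤ b * ‖x‖ ^ 2 + B ^ 2 / (4 * b) := by
      have : b * ‖x‖ ^ 2 + B ^ 2 / (4 * b) - B * ‖x‖ = b * (‖x‖ - B / (2 * b)) ^ 2 := by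
        field_simp; ring
      have : 0 ≤ b * (‖x‖ - B / (2 * b)) ^ 2 := by positivity
      linarith
    have h7 : (1 - κ) = 4 * b := by rw [hb]; ring
    have h8 : κ = 1 - 4 * b := by linarith
    have h9 : Real.log (w x) - ‖x‖ ^ 2 / 2 ≤ A + B * ‖x‖ - (1 - κ) / 2 * ‖x‖ ^ 2 := by
      simp only [A, B]
      linarith
    rw [h7] at h9
    linarith
  · rw [hw.dens_eq_zero hx]
    positivity

lemma integrable_dens (hw : IsAdmissible w) : Integrable (dens w) volume := by
  obtain ⟨C, b, hb, h⟩ := hw.exists_dens_le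
  have hi : Integrable (fun v : E n => Real.exp (-b * ‖v‖ ^ 2)) volume := by
    refine Integrable.of_integral_ne_zero ?_
    rw [GaussianFourier.integral_rexp_neg_mul_sq_norm hb]
    positivity
  refine (hi.const_mul C).mono' hw.measurable_dens.aestronglyMeasurable (.of_forall fun x => ?_)
  rw [Real.norm_of_nonneg (hw.dens_nonneg x)]
  exact h x

lemma lintegral_preMeasure (hw : IsAdmissible w) {f : E n → ENNReal} (hf : Measurable f) :
    ∫⁻ x, f x ∂preMeasure w = ∫⁻ x, ENNReal.ofReal (dens w x) * f x := by
  have hd := hw.measurable_dens.ennreal_ofReal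
  unfold dens at hd
  rw [preMeasure, lintegral_withDensity_eq_lintegral_mul _ hd hf, ← lintegral_indicator
    hw.isOpen.measurableSet]
  refine lintegral_congr fun x => ?_
  by_cases hx : x ∈ posSet w
  · simp [hx, dens]
  · simp [hx, hw.dens_eq_zero hx]

lemma preMeasure_univ (hw : IsAdmissible w) :
    preMeasure w Set.univ = ∫⁻ x, ENNReal.ofReal (dens w x) := by
  rw [← lintegral_one, hw.lintegral_preMeasure measurable_const]
  simp

lemma preMeasure_univ_ne_top (hw : IsAdmissible w) : preMeasure w Set.univ ≠ ⊤ := by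
  rw [hw.preMeasure_univ]
  exact hw.integrable_dens.lintegral_lt_top.ne

lemma preMeasure_univ_ne_zero (hw : IsAdmissible w) : preMeasure w Set.univ ≠ 0 := by
  rw [hw.preMeasure_univ]
  intro h
  rw [lintegral_eq_zero_iff hw.measurable_dens.ennreal_ofReal] at h
  have : volume (posSet w) = 0 := by
    refine measure_mono_null (fun x hx => ?_) h
    simpa using dens_pos hx
  exact (hw.isOpen.measure_pos volume hw.nonempty).ne' this

lemma isProbabilityMeasure (hw : IsAdmissible w) : IsProbabilityMeasure (muW w) :=
  ⟨by
    simpa [muW] using ENNReal.inv_mul_cancel hw.preMeasure_univ_ne_zero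
      hw.preMeasure_univ_ne_top⟩

lemma lintegral_muW (hw : IsAdmissible w) {f : E n → ENNReal} (hf : Measurable f) :
    ∫⁻ x, f x ∂muW w =
      (preMeasure w Set.univ)⁻¹ * ∫⁻ x, ENNReal.ofReal (dens w x) * f x := by
  rw [muW, lintegral_smul_measure, hw.lintegral_preMeasure hf, smul_eq_mul]

lemma ae_mem_posSet (hw : IsAdmissible w) : ∀ᵐ x ∂muW w, x ∈ posSet w := by
  refine Measure.ae_smul_measure ?_ _
  exact (withDensity_absolutelyContinuous _ _).ae_le (ae_restrict_mem hw.isOpen.measurableSet)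

end IsAdmissible

end WeightedGaussian

/-! ### The logarithmic Sobolev inequality for smooth functions -/

namespace WeightedGaussian

variable {n : ℕ} {w : E n → ℝ}

/-- The first-order Taylor bound with quadratic remainder, for a function with Lipschitz
derivative. -/
lemma taylor_le_of_lipschitz {g : E n → ℝ} (hg : Differentiable ℝ g) {M : NNReal}
    (hM : LipschitzWith M (fderiv ℝ g)) (x z : E n) :
    g x ≤ g z + ‖fderiv ℝ g z‖ * ‖x - z‖ + M * ‖x - z‖ ^ 2 := by
  have h := (convex_segment (𝕜 := ℝ) z x).norm_image_sub_le_of_norm_hasFDerivWithin_le'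
    (f := g) (f' := fderiv ℝ g) (φ := fderiv ℝ g z) (C := M * ‖x - z‖)
    (fun y _ => (hg y).hasFDerivAt.hasFDerivWithinAt)
    (fun y hy => (hM.norm_sub_le y z).trans (by
      gcongr
      exact norm_sub_le_of_mem_segment hy))
    (left_mem_segment ℝ z x) (right_mem_segment ℝ z x)
  have h1 := (le_abs_self _).trans ((Real.norm_eq_abs _).ge.trans h)
  have h2 : fderiv ℝ g z (x - z) ≤ ‖fderiv ℝ g z‖ * ‖x - z‖ :=
    (le_abs_self _).trans ((Real.norm_eq_abs _).ge.trans (ContinuousLinearMap.le_opNorm _ _))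
  nlinarith

/-- The consequence of Prékopa–Leindler that linearizes, as `δ → 0`, to the logarithmic Sobolev
inequality. The supremal convolution in the usual argument is replaced by the explicit upper bound
`g + δ κ ‖Dg‖²`. -/
lemma IsAdmissible.lintegral_rpow_le (hw : IsAdmissible w) {K : ℝ} (hK : HessBound w K)
    {g : E n → ℝ} (hg : ContDiff ℝ 1 g) {M : NNReal} (hM : LipschitzWith M (fderiv ℝ g))
    {κ δ : ℝ} (hκ : 0 < κ) (hδ : 0 < δ) (hsmall : M * δ + 1 / (4 * κ) ≤ (1 + K) / 2) :
    (∫⁻ x, ENNReal.ofReal (Real.exp ((1 + δ) * g x)) ∂muW w) ^ (1 / (1 + δ)) ≤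
      ∫⁻ x, ENNReal.ofReal (Real.exp (g x + δ * (κ * ‖fderiv ℝ g x‖ ^ 2))) ∂muW w := by
  set r := 1 / (1 + δ) with hr
  set s := δ / (1 + δ) with hs
  have hr0 : 0 < r := by positivity
  have hs0 : 0 < s := by positivity
  have hrs : r + s = 1 := by rw [hr, hs]; field_simp
  have hgm : Measurable g := hg.continuous.measurable
  have hfm : Measurable (fderiv ℝ g) := (hg.continuous_fderiv (by norm_num)).measurable
  have hdm := hw.measurable_dens
  -- the pointwise hypothesis of Prékopa–Leindler
  have key : ∀ x ∈ posSet w, ∀ y ∈ posSet w,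
      r * ((1 + δ) * g x + Real.log (dens w x)) + s * Real.log (dens w y) ≤
      g (r • x + s • y) + δ * (κ * ‖fderiv ℝ g (r • x + s • y)‖ ^ 2) +
        Real.log (dens w (r • x + s • y)) := by
    intro x hx y hy
    have h1 := hw.log_dens_combo hK hx hy hr0.le hs0.le hrs
    set z := r • x + s • y with hz
    have hxz : x - z = s • (x - y) := by
      have : r = 1 - s := by linarith
      rw [hz, this]; module
    have hnorm : ‖x - z‖ = s * ‖x - y‖ := by
      rw [hxz, norm_smul, Real.norm_of_nonneg hs0.le]
    have hsq : r * s * ‖x - y‖ ^ 2 = ‖x - z‖ ^ 2 / δ := by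
      rw [hnorm, hr, hs]; field_simp
    have h2 := taylor_le_of_lipschitz (hg.differentiable (by norm_num)) hM x z
    have h3 : ‖fderiv ℝ g z‖ * ‖x - z‖ ≤
        δ * (κ * ‖fderiv ℝ g z‖ ^ 2) + 1 / (4 * κ) * (‖x - z‖ ^ 2 / δ) := by
      have e : δ * (κ * ‖fderiv ℝ g z‖ ^ 2) + 1 / (4 * κ) * (‖x - z‖ ^ 2 / δ)
          - ‖fderiv ℝ g z‖ * ‖x - z‖ =
          δ * κ * (‖fderiv ℝ g z‖ - ‖x - z‖ / (2 * κ * δ)) ^ 2 := by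
        field_simp; ring
      have : 0 ≤ δ * κ * (‖fderiv ℝ g z‖ - ‖x - z‖ / (2 * κ * δ)) ^ 2 := by positivity
      linarith
    have h4 : (M * δ + 1 / (4 * κ)) * (‖x - z‖ ^ 2 / δ) ≤
        (1 + K) / 2 * (‖x - z‖ ^ 2 / δ) := by gcongr
    have h5 : M * δ * (‖x - z‖ ^ 2 / δ) = M * ‖x - z‖ ^ 2 := by field_simp
    have h6 : r * ((1 + δ) * g x) = g x := by rw [hr]; field_simp
    rw [add_mul, h5] at h4
    rw [mul_assoc ((1 + K) / 2), hsq] at h1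
    rw [mul_add, h6]
    linarith
  have PL := PrekopaLeindler.euclidean hr0 hs0 hrs
    (U := fun x => ENNReal.ofReal (dens w x) * ENNReal.ofReal (Real.exp ((1 + δ) * g x)))
    (V := fun x => ENNReal.ofReal (dens w x))
    (W := fun x => ENNReal.ofReal (dens w x) *
      ENNReal.ofReal (Real.exp (g x + δ * (κ * ‖fderiv ℝ g x‖ ^ 2))))
    (by fun_prop) (by fun_prop) (by fun_prop) (fun x y => ?_)
  · rw [hw.lintegral_muW (by fun_prop), hw.lintegral_muW (by fun_prop)]
    rw [← hw.preMeasure_univ] at PL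
    set Z := preMeasure w Set.univ
    have hZ0 : Z ≠ 0 := hw.preMeasure_univ_ne_zero
    have hZt : Z ≠ ⊤ := hw.preMeasure_univ_ne_top
    rw [ENNReal.mul_rpow_of_nonneg _ _ hr0.le, ENNReal.inv_rpow]
    have e : (Z ^ r)⁻¹ = Z⁻¹ * Z ^ s := by
      have hZr0 : Z ^ r ≠ 0 := by simp [hZ0, hZt]
      have hZrt : Z ^ r ≠ ⊤ := ENNReal.rpow_ne_top_of_nonneg hr0.le hZt
      have h1 : Z ^ s * Z ^ r = Z := by
        rw [← ENNReal.rpow_add_of_nonneg _ _ hs0.le hr0.le, add_comm, hrs, ENNReal.rpow_one]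
      have h2 : Z⁻¹ * Z ^ s * Z ^ r = 1 := by
        rw [mul_assoc, h1, ENNReal.inv_mul_cancel hZ0 hZt]
      exact (ENNReal.eq_inv_of_mul_eq_one_left h2).symm
    rw [e, mul_assoc, mul_comm (Z ^ s)]
    gcongr
  · by_cases hx : x ∈ posSet w
    · by_cases hy : y ∈ posSet w
      · have hz := hw.convex hx hy hr0.le hs0.le hrs
        rw [← ENNReal.ofReal_mul (hw.dens_nonneg _), ← ENNReal.ofReal_mul (hw.dens_nonneg _)]
        have ex : ∀ {u : E n} (_ : u ∈ posSet w) (a : ℝ),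
            dens w u * Real.exp a = Real.exp (a + Real.log (dens w u)) := by
          intro u hu a
          rw [Real.exp_add, Real.exp_log (dens_pos hu), mul_comm]
        have ey : dens w y = Real.exp (Real.log (dens w y)) := (Real.exp_log (dens_pos hy)).symm
        rw [ex hx, ex hz, ey, ENNReal.ofReal_rpow_of_pos (Real.exp_pos _),
          ENNReal.ofReal_rpow_of_pos (Real.exp_pos _), ← ENNReal.ofReal_mul
          (Real.rpow_nonneg (Real.exp_pos _).le _), ← Real.exp_mul, ← Real.exp_mul,
          ← Real.exp_add]
        refine ENNReal.ofReal_le_ofReal (Real.exp_le_exp.2 ?_)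
        have := key x hx y hy
        rwa [mul_comm _ r, mul_comm _ s]
      · simp [hw.dens_eq_zero hy, hs0]
    · simp [hw.dens_eq_zero hx, hr0]

lemma hasDerivAt_integral_exp {α : Type*} [MeasurableSpace α] {μ : Measure α}
    [IsProbabilityMeasure μ] {a b : α → ℝ} (ha : Measurable a) (hb : Measurable b) {C : ℝ}
    (haC : ∀ x, |a x| ≤ C) (hbC : ∀ x, |b x| ≤ C) :
    HasDerivAt (fun δ : ℝ => ∫ x, Real.exp (a x + δ * b x) ∂μ)
      (∫ x, b x * Real.exp (a x) ∂μ) 0 := by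
  have hbd : ∀ x, ∀ δ ∈ Metric.ball (0 : ℝ) 1,
      Real.exp (a x + δ * b x) ≤ Real.exp (C + C) := by
    intro x δ hδ
    rw [mem_ball_zero_iff, Real.norm_eq_abs] at hδ
    rw [Real.exp_le_exp]
    refine add_le_add ((le_abs_self _).trans (haC x)) ((le_abs_self _).trans ?_)
    rw [abs_mul]
    calc |δ| * |b x| ≤ 1 * C := mul_le_mul hδ.le (hbC x) (abs_nonneg _) zero_le_one
      _ = C := one_mul C
  have := (hasDerivAt_integral_of_dominated_loc_of_deriv_le (μ := μ) (x₀ := (0 : ℝ))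
    (F := fun δ x => Real.exp (a x + δ * b x)) (F' := fun δ x => b x * Real.exp (a x + δ * b x))
    (bound := fun _ => C * Real.exp (C + C)) (s := Metric.ball 0 1)
    (Metric.ball_mem_nhds _ one_pos) (.of_forall fun δ => by fun_prop)
    (Integrable.of_bound (by fun_prop) (Real.exp (C + C)) (.of_forall fun x => by
      rw [Real.norm_of_nonneg (Real.exp_pos _).le]
      exact hbd x 0 (by simp))) (by fun_prop)
    (.of_forall fun x δ hδ => by
      rw [norm_mul, Real.norm_of_nonneg (Real.exp_pos _).le, Real.norm_eq_abs]
      exact mul_le_mul (hbC x) (hbd x δ hδ) (Real.exp_pos _).le ((abs_nonneg _).trans (hbC x)))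
    (integrable_const _)
    (.of_forall fun x δ _ => by
      have h1 : HasDerivAt (fun δ : ℝ => a x + δ * b x) (b x) δ := by
        simpa using ((hasDerivAt_id δ).mul_const (b x)).const_add (a x)
      simpa [mul_comm] using h1.exp)).2
  simpa using this

lemma deriv_nonneg_of_eventually {f : ℝ → ℝ} {f' : ℝ} (hf : HasDerivAt f f' 0) (h0 : f 0 = 0)
    (h : ∀ᶠ δ in 𝓝[>] 0, 0 ≤ f δ) : 0 ≤ f' := by
  have h1 := (hasDerivWithinAt_iff_tendsto_slope' (s := Set.Ioi (0 : ℝ)) (by simp)).1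
    hf.hasDerivWithinAt
  refine ge_of_tendsto h1 ?_
  filter_upwards [h, self_mem_nhdsWithin] with δ hδ hpos
  rw [slope_def_field, h0]
  exact div_nonneg (by simpa using hδ) (by simpa using le_of_lt hpos)

/-- Linearization at `δ = 0` of a family of inequalities between exponential moments. -/
lemma entropy_le_of_moments {α : Type*} [MeasurableSpace α] {μ : Measure α}
    [IsProbabilityMeasure μ] {g H : α → ℝ} (hg : Measurable g) (hH : Measurable H) {C : ℝ}
    (hgC : ∀ x, |g x| ≤ C) (hHC : ∀ x, |H x| ≤ C)
    (h : ∀ᶠ δ in 𝓝[>] (0 : ℝ), Real.log (∫ x, Real.exp (g x + δ * g x) ∂μ) ≤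
      (1 + δ) * Real.log (∫ x, Real.exp (g x + δ * H x) ∂μ)) :
    ∫ x, g x * Real.exp (g x) ∂μ - (∫ x, Real.exp (g x) ∂μ) * Real.log (∫ x, Real.exp (g x) ∂μ) ≤
      ∫ x, H x * Real.exp (g x) ∂μ := by
  set m := ∫ x, Real.exp (g x) ∂μ with hm
  have hint : Integrable (fun x => Real.exp (g x)) μ :=
    Integrable.of_bound (by fun_prop) (Real.exp C) (.of_forall fun x => by
      rw [Real.norm_of_nonneg (Real.exp_pos _).le, Real.exp_le_exp]
      exact (le_abs_self _).trans (hgC x))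
  have hm0 : 0 < m := integral_exp_pos hint
  have d1 := hasDerivAt_integral_exp (μ := μ) hg hg hgC hgC
  have d2 := hasDerivAt_integral_exp (μ := μ) hg hH hgC hHC
  have l1 := d1.log (by simpa using hm0.ne')
  have l2 := d2.log (by simpa using hm0.ne')
  have l3 := (((hasDerivAt_id (0 : ℝ)).const_add 1).mul l2).sub l1
  have := deriv_nonneg_of_eventually l3 (by simp) (by
    filter_upwards [h] with δ hδ
    simpa using hδ)
  simp only [id, zero_mul, add_zero, one_mul, ← hm] at this
  have h2 := mul_le_mul_of_nonneg_left this hm0.le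
  rw [mul_zero, mul_sub, mul_add, mul_div_cancel₀ _ hm0.ne', mul_div_cancel₀ _ hm0.ne'] at h2
  linarith

/-- The logarithmic Sobolev inequality in exponential form. -/
lemma IsAdmissible.entropy_exp_le (hw : IsAdmissible w) {K : ℝ} (hK1 : -1 < K)
    (hK : HessBound w K) {g : E n → ℝ} (hg : ContDiff ℝ 1 g) {M : NNReal}
    (hM : LipschitzWith M (fderiv ℝ g)) {C : ℝ} (hgC : ∀ x, |g x| ≤ C)
    (hDC : ∀ x, ‖fderiv ℝ g x‖ ≤ C) :
    ∫ x, g x * Real.exp (g x) ∂muW w -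
        (∫ x, Real.exp (g x) ∂muW w) * Real.log (∫ x, Real.exp (g x) ∂muW w) ≤
      1 / (2 * (1 + K)) * ∫ x, ‖fderiv ℝ g x‖ ^ 2 * Real.exp (g x) ∂muW w := by
  have := hw.isProbabilityMeasure
  have hgm : Measurable g := hg.continuous.measurable
  have hfm : Measurable (fderiv ℝ g) := (hg.continuous_fderiv (by norm_num)).measurable
  have hρ : 0 < 1 + K := by linarith
  have hlim : Tendsto (fun κ : ℝ => κ * ∫ x, ‖fderiv ℝ g x‖ ^ 2 * Real.exp (g x) ∂muW w)
      (𝓝[>] (1 / (2 * (1 + K)))) (𝓝 (1 / (2 * (1 + K)) *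
        ∫ x, ‖fderiv ℝ g x‖ ^ 2 * Real.exp (g x) ∂muW w)) :=
    ((continuous_id.mul continuous_const).tendsto _).mono_left nhdsWithin_le_nhds
  refine ge_of_tendsto hlim ?_
  filter_upwards [self_mem_nhdsWithin] with κ (hκ : 1 / (2 * (1 + K)) < κ)
  have hκ0 : 0 < κ := lt_trans (by positivity) hκ
  have hC0 : 0 ≤ C := (abs_nonneg _).trans (hgC 0)
  have hHC : ∀ x, |κ * ‖fderiv ℝ g x‖ ^ 2| ≤ max C (κ * C ^ 2) := fun x => by
    rw [abs_of_nonneg (by positivity)]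
    exact le_max_of_le_right (by gcongr; exact hDC x)
  have key := entropy_le_of_moments (μ := muW w) (g := g) (H := fun x => κ * ‖fderiv ℝ g x‖ ^ 2)
    hgm (by fun_prop) (fun x => (hgC x).trans (le_max_left _ _)) hHC ?_
  · simpa only [mul_assoc, integral_const_mul] using key
  have hsm : 1 / (4 * κ) < (1 + K) / 2 := by
    rw [div_lt_iff₀ (by positivity)] at hκ ⊢
    linarith
  have ev : ∀ᶠ δ in 𝓝[>] (0 : ℝ), M * δ + 1 / (4 * κ) < (1 + K) / 2 := by
    have : Tendsto (fun δ : ℝ => M * δ + 1 / (4 * κ)) (𝓝[>] 0) (𝓝 (M * 0 + 1 / (4 * κ))) :=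
      (Continuous.tendsto (by fun_prop) _).mono_left nhdsWithin_le_nhds
    exact this.eventually_lt_const (by simpa using hsm)
  filter_upwards [ev, self_mem_nhdsWithin] with δ hδ (hδ0 : 0 < δ)
  have h1 := hw.lintegral_rpow_le hK hg hM hκ0 hδ0 hδ.le
  have hbound : ∀ (b : E n → ℝ) (D : ℝ), (∀ x, |b x| ≤ D) → Measurable b →
      Integrable (fun x => Real.exp (g x + δ * b x)) (muW w) := fun b D hb hbm =>
    Integrable.of_bound (by fun_prop) (Real.exp (C + δ * D)) (.of_forall fun x => by
      rw [Real.norm_of_nonneg (Real.exp_pos _).le, Real.exp_le_exp]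
      have := (le_abs_self _).trans (hgC x)
      have := (le_abs_self _).trans (hb x)
      gcongr)
  have i1 := hbound g C hgC hgm
  have i2 := hbound _ _ hHC (by fun_prop)
  have e1 : ∀ x, (1 + δ) * g x = g x + δ * g x := fun x => by ring
  simp only [e1] at h1
  rw [← ofReal_integral_eq_lintegral_ofReal i1 (.of_forall fun x => (Real.exp_pos _).le),
    ← ofReal_integral_eq_lintegral_ofReal i2 (.of_forall fun x => (Real.exp_pos _).le),
    ENNReal.ofReal_rpow_of_pos (integral_exp_pos i1)] at h1
  rw [ENNReal.ofReal_le_ofReal_iff (integral_exp_pos i2).le] at h1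
  have h2 := Real.log_le_log (Real.rpow_pos_of_pos (integral_exp_pos i1) _) h1
  rw [Real.log_rpow (integral_exp_pos i1), one_div, inv_mul_le_iff₀ (by linarith)] at h2
  exact h2

/-- The logarithmic Sobolev inequality for the positive function `u² + ε`. -/
lemma IsAdmissible.entropy_sq_add_le (hw : IsAdmissible w) {K : ℝ} (hK1 : -1 < K)
    (hK : HessBound w K) {u : E n → ℝ} (hu : ContDiff ℝ ∞ u) (huc : HasCompactSupport u)
    {ε : ℝ} (hε : 0 < ε) :
    Ent (muW w) (fun x => u x ^ 2 + ε) ≤ 2 / (1 + K) * ∫ x, ‖fderiv ℝ u x‖ ^ 2 ∂muW w := by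
  have := hw.isProbabilityMeasure
  have hpos : ∀ x, 0 < u x ^ 2 + ε := fun x => by positivity
  set g : E n → ℝ := fun x => Real.log (u x ^ 2 + ε) with hg_def
  have hg : ContDiff ℝ ∞ g := ((hu.pow 2).add contDiff_const).log fun x => (hpos x).ne'
  set g₀ : E n → ℝ := fun x => g x - Real.log ε with hg₀_def
  have hg₀ : ContDiff ℝ ∞ g₀ := hg.sub contDiff_const
  have hg₀c : HasCompactSupport g₀ := huc.mono' fun x hx => by
    by_contra hux
    exact hx (by simp [hg₀_def, hg_def, image_eq_zero_of_notMem_tsupport hux])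
  have hD : fderiv ℝ g₀ = fderiv ℝ g := by
    ext1 x
    exact fderiv_sub_const _
  have hDc : HasCompactSupport (fderiv ℝ g) := hD ▸ hg₀c.fderiv (𝕜 := ℝ)
  have hD1 : ContDiff ℝ 1 (fderiv ℝ g) := hg.fderiv_right (by norm_cast)
  obtain ⟨M, hM⟩ := hD1.lipschitzWith_of_hasCompactSupport hDc (by norm_num)
  obtain ⟨C₁, hC₁⟩ := hg₀.continuous.bounded_above_of_compact_support hg₀c
  obtain ⟨C₂, hC₂⟩ := hD1.continuous.bounded_above_of_compact_support hDc
  have h := hw.entropy_exp_le hK1 hK (hg.of_le (by norm_cast)) hM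
    (C := max (C₁ + |Real.log ε|) C₂) (fun x => le_max_of_le_left ?_)
    (fun x => le_max_of_le_right (hC₂ x))
  · have e1 : ∀ x, Real.exp (g x) = u x ^ 2 + ε := fun x => Real.exp_log (hpos x)
    simp only [e1] at h
    have e2 : Ent (muW w) (fun x => u x ^ 2 + ε) = ∫ x, g x * (u x ^ 2 + ε) ∂muW w -
        (∫ x, u x ^ 2 + ε ∂muW w) * Real.log (∫ x, u x ^ 2 + ε ∂muW w) := by
      simp only [Ent, hg_def, mul_comm]
    rw [e2]
    refine h.trans ?_
    obtain ⟨C₃, hC₃⟩ := (hu.continuous_fderiv (by simp)).bounded_above_of_compact_support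
      (huc.fderiv (𝕜 := ℝ))
    have hpt : ∀ x, ‖fderiv ℝ g x‖ ^ 2 * (u x ^ 2 + ε) ≤ 4 * ‖fderiv ℝ u x‖ ^ 2 := by
      intro x
      have hdu : HasFDerivAt u (fderiv ℝ u x) x :=
        (hu.differentiable (by simp) x).hasFDerivAt
      have hdg : fderiv ℝ g x = (2 * u x / (u x ^ 2 + ε)) • fderiv ℝ u x := by
        have := (((hdu.pow 2).add_const ε).log (hpos x).ne').fderiv
        rw [hg_def, this]
        simp [smul_smul, div_eq_inv_mul]
      rw [hdg, norm_smul, mul_pow, Real.norm_eq_abs, sq_abs, div_pow]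
      have : (2 * u x) ^ 2 / (u x ^ 2 + ε) ^ 2 * ‖fderiv ℝ u x‖ ^ 2 * (u x ^ 2 + ε) =
          4 * ‖fderiv ℝ u x‖ ^ 2 * (u x ^ 2 / (u x ^ 2 + ε)) := by
        have := (hpos x).ne'
        field_simp
        ring
      rw [this]
      refine mul_le_of_le_one_right (by positivity) ?_
      rw [div_le_one (hpos x)]
      linarith
    have hmono : ∫ x, ‖fderiv ℝ g x‖ ^ 2 * (u x ^ 2 + ε) ∂muW w ≤
        ∫ x, 4 * ‖fderiv ℝ u x‖ ^ 2 ∂muW w := by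
      refine integral_mono_of_nonneg (.of_forall fun x => mul_nonneg (by positivity) (hpos x).le)
        ?_ (.of_forall hpt)
      refine Integrable.of_bound (C := 4 * C₃ ^ 2) ?_ (.of_forall fun x => ?_)
      · have := hu.continuous_fderiv (by simp)
        exact Continuous.aestronglyMeasurable (by fun_prop)
      · rw [Real.norm_of_nonneg (by positivity)]
        gcongr
        exact hC₃ x
    rw [integral_const_mul] at hmono
    have hρ : 0 < 1 + K := by linarith
    calc 1 / (2 * (1 + K)) * ∫ x, ‖fderiv ℝ g x‖ ^ 2 * (u x ^ 2 + ε) ∂muW w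
        ≤ 1 / (2 * (1 + K)) * (4 * ∫ x, ‖fderiv ℝ u x‖ ^ 2 ∂muW w) := by gcongr
      _ = 2 / (1 + K) * ∫ x, ‖fderiv ℝ u x‖ ^ 2 ∂muW w := by field_simp; ring
  · have : g x = g₀ x + Real.log ε := by simp [hg₀_def]
    rw [this]
    exact (abs_add_le _ _).trans (by gcongr; exact hC₁ x)

/-- The logarithmic Sobolev inequality for smooth compactly supported functions. No boundary
condition is needed. -/
theorem IsAdmissible.entropy_sq_le (hw : IsAdmissible w) {K : ℝ} (hK1 : -1 < K)
    (hK : HessBound w K) {u : E n → ℝ} (hu : ContDiff ℝ ∞ u) (huc : HasCompactSupport u) :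
    Ent (muW w) (fun x => u x ^ 2) ≤ 2 / (1 + K) * ∫ x, ‖fderiv ℝ u x‖ ^ 2 ∂muW w := by
  have := hw.isProbabilityMeasure
  obtain ⟨C, hC⟩ := hu.continuous.bounded_above_of_compact_support huc
  have hC2 : ∀ x, u x ^ 2 ≤ C ^ 2 := fun x => by
    rw [← sq_abs, ← Real.norm_eq_abs]
    gcongr
    exact hC x
  have hsub : ∀ ε ∈ Set.Ioc (0 : ℝ) 1, ∀ x, u x ^ 2 + ε ∈ Set.Icc (0 : ℝ) (C ^ 2 + 1) :=
    fun ε hε x => ⟨by have := hε.1; positivity, add_le_add (hC2 x) hε.2⟩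
  obtain ⟨B, hB⟩ := isCompact_Icc.exists_bound_of_continuousOn
    (Real.continuous_mul_log.continuousOn (s := Set.Icc (0 : ℝ) (C ^ 2 + 1)))
  have hev : ∀ᶠ ε in 𝓝[>] (0 : ℝ), ε ∈ Set.Ioc (0 : ℝ) 1 := Ioc_mem_nhdsGT one_pos
  have hpt : ∀ x, Tendsto (fun ε : ℝ => u x ^ 2 + ε) (𝓝[>] 0) (𝓝 (u x ^ 2)) := fun x => by
    have : Tendsto (fun ε : ℝ => u x ^ 2 + ε) (𝓝[>] 0) (𝓝 (u x ^ 2 + 0)) :=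
      (Continuous.tendsto (by fun_prop) _).mono_left nhdsWithin_le_nhds
    simpa using this
  have hcu := hu.continuous
  have t1 : Tendsto (fun ε : ℝ => ∫ x, (u x ^ 2 + ε) * Real.log (u x ^ 2 + ε) ∂muW w) (𝓝[>] 0)
      (𝓝 (∫ x, u x ^ 2 * Real.log (u x ^ 2) ∂muW w)) := by
    refine tendsto_integral_filter_of_dominated_convergence (fun _ => B) (.of_forall fun ε => ?_)
      ?_ (integrable_const _) (.of_forall fun x => ?_)
    · exact (Real.continuous_mul_log.comp
        (by fun_prop : Continuous fun x => u x ^ 2 + ε)).aestronglyMeasurable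
    · filter_upwards [hev] with ε hε
      exact .of_forall fun x => hB _ (hsub ε hε x)
    · exact (Real.continuous_mul_log.tendsto _).comp (hpt x)
  have t2 : Tendsto (fun ε : ℝ => ∫ x, u x ^ 2 + ε ∂muW w) (𝓝[>] 0)
      (𝓝 (∫ x, u x ^ 2 ∂muW w)) := by
    refine tendsto_integral_filter_of_dominated_convergence (fun _ => C ^ 2 + 1)
      (.of_forall fun ε => ?_) ?_ (integrable_const _) (.of_forall hpt)
    · exact Continuous.aestronglyMeasurable (by fun_prop)
    · filter_upwards [hev] with ε hε
      refine .of_forall fun x => ?_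
      rw [Real.norm_of_nonneg (hsub ε hε x).1]
      exact (hsub ε hε x).2
  have t3 := t1.sub ((Real.continuous_mul_log.tendsto _).comp t2)
  refine le_of_tendsto t3 ?_
  filter_upwards [self_mem_nhdsWithin] with ε (hε : 0 < ε)
  exact hw.entropy_sq_add_le hK1 hK hu huc hε

end WeightedGaussian

/-! ### Passage to the Sobolev space -/

namespace WeightedGaussian

variable {n : ℕ} {w : E n → ℝ}

lemma tendsto_integral_norm_sq {α F : Type*} [MeasurableSpace α] {μ : Measure α}
    [NormedAddCommGroup F] {u : ℕ → α → F} {f : α → F} (hu : ∀ k, MemLp (u k) 2 μ)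
    (hf : MemLp f 2 μ) (h : Tendsto (fun k => eLpNorm (fun x => u k x - f x) 2 μ) atTop (𝓝 0)) :
    Tendsto (fun k => ∫ x, ‖u k x‖ ^ 2 ∂μ) atTop (𝓝 (∫ x, ‖f x‖ ^ 2 ∂μ)) := by
  have e : ∀ {v : α → F} (hv : MemLp v 2 μ), ∫ x, ‖v x‖ ^ 2 ∂μ = ‖hv.toLp v‖ ^ 2 := by
    intro v hv
    have h0 : 0 ≤ ∫ x, ‖v x‖ ^ 2 ∂μ := integral_nonneg fun x => by positivity
    rw [Lp.norm_toLp, hv.eLpNorm_eq_integral_rpow_norm (by norm_num) (by norm_num)]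
    simp only [ENNReal.toReal_ofNat, Real.rpow_ofNat]
    rw [ENNReal.toReal_ofReal (by positivity), ← Real.rpow_natCast, ← Real.rpow_mul h0]
    norm_num
  simp only [e (hu _), e hf]
  exact ((Lp.tendsto_Lp_iff_tendsto_eLpNorm'' u hu f hf).2 h).norm.pow 2

lemma mul_log_add_one_nonneg {x : ℝ} (hx : 0 ≤ x) : 0 ≤ x * Real.log x + 1 := by
  rcases hx.eq_or_lt with rfl | hx
  · simp
  · have := mul_le_mul_of_nonneg_left (Real.one_sub_inv_le_log_of_pos hx) hx.le
    rw [mul_sub, mul_inv_cancel₀ hx.ne'] at this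
    linarith

lemma norm_gradient (u : E n → ℝ) (x : E n) : ‖gradient u x‖ = ‖fderiv ℝ u x‖ := by
  simp [gradient]

lemma continuous_gradient {u : E n → ℝ} (hu : ContDiff ℝ ∞ u) : Continuous (gradient u) :=
  (InnerProductSpace.toDual ℝ (E n)).symm.continuous.comp (hu.continuous_fderiv (by simp))

lemma hasCompactSupport_gradient {u : E n → ℝ} (hu : HasCompactSupport u) :
    HasCompactSupport (gradient u) :=
  (hu.fderiv (𝕜 := ℝ)).comp_left (map_zero (InnerProductSpace.toDual ℝ (E n)).symm)

lemma memLp_of_compactSupport {F : Type*} [NormedAddCommGroup F] {μ : Measure (E n)}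
    [IsProbabilityMeasure μ] {u : E n → F} (hu : Continuous u) (hc : HasCompactSupport u) :
    MemLp u 2 μ :=
  hu.memLp_of_hasCompactSupport hc

/-- The logarithmic Sobolev inequality on the Sobolev space. The entropy integrand is bounded
below, so Fatou's lemma passes it to the limit along an almost everywhere convergent
subsequence. -/
theorem IsAdmissible.entropy_le (hw : IsAdmissible w) {K : ℝ} (hK1 : -1 < K)
    (hK : HessBound w K) {f : E n → ℝ} {g : E n → E n} (h : MemSobolevA w f g) :
    Integrable (fun x => f x ^ 2 * Real.log (f x ^ 2)) (muW w) ∧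
      Ent (muW w) (fun x => f x ^ 2) ≤ 2 / (1 + K) * ∫ x, ‖g x‖ ^ 2 ∂muW w := by
  have := hw.isProbabilityMeasure
  obtain ⟨u, huA, huf, hug⟩ := h.approx
  have hul : ∀ k, MemLp (u k) 2 (muW w) := fun k =>
    memLp_of_compactSupport (huA k).1.continuous (huA k).2.1
  have hugl : ∀ k, MemLp (gradient (u k)) 2 (muW w) := fun k =>
    memLp_of_compactSupport (continuous_gradient (huA k).1) (hasCompactSupport_gradient (huA k).2.1)
  have t1 := tendsto_integral_norm_sq hul h.memLp_fun huf
  have t2 := tendsto_integral_norm_sq hugl h.memLp_grad hug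
  simp only [Real.norm_eq_abs, sq_abs] at t1
  obtain ⟨ns, hns, hae⟩ := (tendstoInMeasure_of_tendsto_eLpNorm (by norm_num)
    (fun k => (hul k).1) h.memLp_fun.1 huf).exists_seq_tendsto_ae
  have hns' := hns.tendsto_atTop
  set m := ∫ x, f x ^ 2 ∂muW w with hm
  set B := 2 / (1 + K) * (∫ x, ‖g x‖ ^ 2 ∂muW w) + m * Real.log m + 1 with hB
  set Φ : ℝ → ℝ := fun t => t ^ 2 * Real.log (t ^ 2) + 1 with hΦ
  have hΦc : Continuous Φ :=
    (Real.continuous_mul_log.comp (continuous_pow 2)).add continuous_const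
  have hΦ0 : ∀ t, 0 ≤ Φ t := fun t => mul_log_add_one_nonneg (sq_nonneg t)
  have hΦf : AEStronglyMeasurable (fun x => Φ (f x)) (muW w) :=
    hΦc.comp_aestronglyMeasurable h.memLp_fun.1
  -- the bound for the approximating functions
  have hk : ∀ k, ∫⁻ x, ENNReal.ofReal (Φ (u k x)) ∂muW w ≤ ENNReal.ofReal
      (2 / (1 + K) * (∫ x, ‖gradient (u k) x‖ ^ 2 ∂muW w) +
        (∫ x, u k x ^ 2 ∂muW w) * Real.log (∫ x, u k x ^ 2 ∂muW w) + 1) := by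
    intro k
    have hi : Integrable (fun x => u k x ^ 2 * Real.log (u k x ^ 2)) (muW w) := by
      refine Continuous.integrable_of_hasCompactSupport
        (Real.continuous_mul_log.comp ((huA k).1.continuous.pow 2)) ?_
      exact (huA k).2.1.comp_left (g := fun t : ℝ => t ^ 2 * Real.log (t ^ 2)) (by simp)
    have hi' : Integrable (fun x => Φ (u k x)) (muW w) := hi.add (integrable_const 1)
    rw [← ofReal_integral_eq_lintegral_ofReal hi'
      (.of_forall fun x => hΦ0 _)]
    refine ENNReal.ofReal_le_ofReal ?_
    have hlsi := hw.entropy_sq_le hK1 hK (huA k).1 (huA k).2.1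
    rw [Ent] at hlsi
    simp only [hΦ, norm_gradient]
    rw [integral_add hi (integrable_const 1)]
    simp only [integral_const, probReal_univ, smul_eq_mul, mul_one]
    linarith
  have hlim : ∫⁻ x, ENNReal.ofReal (Φ (f x)) ∂muW w ≤ ENNReal.ofReal B := by
    calc ∫⁻ x, ENNReal.ofReal (Φ (f x)) ∂muW w
        = ∫⁻ x, liminf (fun i => ENNReal.ofReal (Φ (u (ns i) x))) atTop ∂muW w := by
          refine lintegral_congr_ae (hae.mono fun x hx => ?_)
          exact (ENNReal.tendsto_ofReal ((hΦc.tendsto _).comp hx)).liminf_eq.symm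
      _ ≤ liminf (fun i => ∫⁻ x, ENNReal.ofReal (Φ (u (ns i) x)) ∂muW w) atTop :=
          lintegral_liminf_le' fun i =>
            (hΦc.comp_aestronglyMeasurable (hul (ns i)).1).aemeasurable.ennreal_ofReal
      _ ≤ liminf (fun i => ENNReal.ofReal
            (2 / (1 + K) * (∫ x, ‖gradient (u (ns i)) x‖ ^ 2 ∂muW w) +
            (∫ x, u (ns i) x ^ 2 ∂muW w) * Real.log (∫ x, u (ns i) x ^ 2 ∂muW w) + 1)) atTop :=
          liminf_le_liminf (.of_forall fun i => hk (ns i))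
      _ = ENNReal.ofReal B := by
          refine (ENNReal.tendsto_ofReal ?_).liminf_eq
          exact (((t2.comp hns').const_mul _).add
            ((Real.continuous_mul_log.tendsto _).comp (t1.comp hns'))).add_const 1
  have hΦi : Integrable (fun x => Φ (f x)) (muW w) := by
    refine ⟨hΦf, ?_⟩
    rw [hasFiniteIntegral_iff_ofReal (.of_forall fun x => hΦ0 _)]
    exact hlim.trans_lt ENNReal.ofReal_lt_top
  have hi : Integrable (fun x => f x ^ 2 * Real.log (f x ^ 2)) (muW w) := by
    refine (hΦi.sub (integrable_const (1 : ℝ))).congr (.of_forall fun x => ?_)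
    simp only [hΦ, Pi.sub_apply, add_sub_cancel_right]
  refine ⟨hi, ?_⟩
  rw [← ofReal_integral_eq_lintegral_ofReal hΦi (.of_forall fun x => hΦ0 _)] at hlim
  have hB0 : 0 ≤ B := by
    refine ge_of_tendsto ((((t2.comp hns').const_mul (2 / (1 + K))).add
      ((Real.continuous_mul_log.tendsto _).comp (t1.comp hns'))).add_const 1)
      (.of_forall fun i => ?_)
    have h1 := mul_log_add_one_nonneg (integral_nonneg (μ := muW w) fun x => sq_nonneg (u (ns i) x))
    have h2 : 0 ≤ 2 / (1 + K) * ∫ x, ‖gradient (u (ns i)) x‖ ^ 2 ∂muW w :=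
      mul_nonneg (div_nonneg zero_le_two (by linarith)) (integral_nonneg fun x => by positivity)
    simp only [Function.comp]
    linarith
  rw [ENNReal.ofReal_le_ofReal_iff hB0] at hlim
  simp only [hΦ] at hlim
  rw [integral_add hi (integrable_const 1)] at hlim
  simp only [integral_const, probReal_univ, smul_eq_mul, mul_one] at hlim
  rw [Ent]
  linarith

end WeightedGaussian

/-! ### Calculus in the Sobolev space -/

namespace WeightedGaussian

variable {n : ℕ} {w : E n → ℝ}

lemma gradient_add {u v : E n → ℝ} {x : E n} (hu : DifferentiableAt ℝ u x)
    (hv : DifferentiableAt ℝ v x) :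
    gradient (fun y => u y + v y) x = gradient u x + gradient v x := by
  simp [gradient, fderiv_fun_add hu hv]

lemma gradient_sub {u v : E n → ℝ} {x : E n} (hu : DifferentiableAt ℝ u x)
    (hv : DifferentiableAt ℝ v x) :
    gradient (fun y => u y - v y) x = gradient u x - gradient v x := by
  simp [gradient, fderiv_fun_sub hu hv]

lemma gradient_mul {u v : E n → ℝ} {x : E n} (hu : DifferentiableAt ℝ u x)
    (hv : DifferentiableAt ℝ v x) :
    gradient (fun y => u y * v y) x = u x • gradient v x + v x • gradient u x := by
  simp [gradient, fderiv_fun_mul hu hv]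

lemma gradient_comp {ψ : ℝ → ℝ} {u : E n → ℝ} {x : E n} (hψ : DifferentiableAt ℝ ψ (u x))
    (hu : DifferentiableAt ℝ u x) :
    gradient (fun y => ψ (u y)) x = deriv ψ (u x) • gradient u x := by
  have h := (hψ.hasDerivAt.comp_hasFDerivAt x hu.hasFDerivAt).fderiv
  simp only [gradient]
  rw [← map_smul, ← h]
  rfl

lemma gradient_comp_smul {u : E n → ℝ} (hu : Differentiable ℝ u) (c : ℝ) (x : E n) :
    gradient (fun y => u (c • y)) x = c • gradient u (c • x) := by
  refine ext_inner_right ℝ fun v => ?_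
  rw [inner_gradient_left, real_inner_smul_left, inner_gradient_left]
  have h1 : HasFDerivAt (fun y : E n => c • y) (c • ContinuousLinearMap.id ℝ (E n)) x :=
    (hasFDerivAt_id x).const_smul c
  have h2 := ((hu (c • x)).hasFDerivAt.comp x h1).fderiv
  have h3 : fderiv ℝ (fun y => u (c • y)) x v =
      (fderiv ℝ u (c • x)).comp (c • ContinuousLinearMap.id ℝ (E n)) v := by
    rw [← h2]; rfl
  rw [h3]
  simp

lemma gradient_sum {ι : Type*} (s : Finset ι) {u : ι → E n → ℝ} {x : E n}
    (hu : ∀ i ∈ s, DifferentiableAt ℝ (u i) x) :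
    gradient (fun y => ∑ i ∈ s, u i y) x = ∑ i ∈ s, gradient (u i) x := by
  simp [gradient, fderiv_fun_sum hu]

lemma differentiableAt_of_smooth {u : E n → ℝ} (hu : ContDiff ℝ ∞ u) {x : E n} :
    DifferentiableAt ℝ u x :=
  hu.differentiable (by simp) x

/-- Dominated convergence in `L²`. -/
lemma tendsto_eLpNorm_two_of_dominated {α F : Type*} [MeasurableSpace α] {μ : Measure α}
    [NormedAddCommGroup F] {u : ℕ → α → F} {b : α → ℝ} (hu : ∀ k, AEStronglyMeasurable (u k) μ)
    (hb : MemLp b 2 μ) (hub : ∀ k, ∀ᵐ x ∂μ, ‖u k x‖ ≤ b x)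
    (h : ∀ᵐ x ∂μ, Tendsto (fun k => u k x) atTop (𝓝 0)) :
    Tendsto (fun k => eLpNorm (u k) 2 μ) atTop (𝓝 0) := by
  simp only [eLpNorm_eq_lintegral_rpow_enorm_toReal (μ := μ) (p := 2) two_ne_zero
    ENNReal.ofNat_ne_top, ENNReal.toReal_ofNat]
  have key : Tendsto (fun k => ∫⁻ x, ‖u k x‖ₑ ^ (2 : ℝ) ∂μ) atTop (𝓝 (∫⁻ _, 0 ∂μ)) := by
    refine tendsto_lintegral_of_dominated_convergence' (fun x => ‖b x‖ₑ ^ (2 : ℝ))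
      (fun k => (hu k).enorm.pow_const _) (fun k => ?_) ?_ ?_
    · filter_upwards [hub k] with x hx
      refine ENNReal.rpow_le_rpow ?_ zero_le_two
      exact enorm_le_iff_norm_le.2 (hx.trans (le_abs_self _))
    · have := lintegral_rpow_enorm_lt_top_of_eLpNorm_lt_top (p := 2) two_ne_zero
        ENNReal.ofNat_ne_top hb.2
      simpa using this.ne
    · filter_upwards [h] with x hx
      have := (hx.enorm).ennrpow_const 2
      simpa using this
  have := key.ennrpow_const (1 / 2)
  simpa using this

lemma eLpNorm_le_add_of_norm_le {α F G H : Type*} [MeasurableSpace α] {μ : Measure α}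
    [NormedAddCommGroup F] [NormedAddCommGroup G] [NormedAddCommGroup H] {u : α → F} {v : α → G}
    {v' : α → H} {C : ℝ} (hv : AEStronglyMeasurable v μ)
    (hv' : AEStronglyMeasurable v' μ) (h : ∀ x, ‖u x‖ ≤ C * (‖v x‖ + ‖v' x‖)) :
    eLpNorm u 2 μ ≤ ENNReal.ofReal C * (eLpNorm v 2 μ + eLpNorm v' 2 μ) := by
  have h1 : eLpNorm u 2 μ ≤ ENNReal.ofReal C * eLpNorm (fun x => ‖v x‖ + ‖v' x‖) 2 μ :=
    eLpNorm_le_mul_eLpNorm_of_ae_le_mul (.of_forall fun x => by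
      rw [Real.norm_of_nonneg (by positivity : 0 ≤ ‖v x‖ + ‖v' x‖)]
      exact h x) 2
  refine h1.trans ?_
  gcongr
  refine (eLpNorm_add_le hv.norm hv'.norm one_le_two).trans ?_
  rw [eLpNorm_norm, eLpNorm_norm]

/-- The approximation property in the Sobolev space, for a single tolerance. -/
lemma MemSobolevA.of_forall_lt {f : E n → ℝ} {g : E n → E n} (hf : MemLp f 2 (muW w))
    (hg : MemLp g 2 (muW w)) (h : ∀ ε : ENNReal, 0 < ε → ∃ u ∈ classA (posSet w),
      eLpNorm (fun x => u x - f x) 2 (muW w) ≤ ε ∧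
      eLpNorm (fun x => gradient u x - g x) 2 (muW w) ≤ ε) : MemSobolevA w f g := by
  have hε : ∀ k : ℕ, (0 : ENNReal) < ((k : ENNReal) + 1)⁻¹ := fun k => by
    rw [ENNReal.inv_pos]
    exact ENNReal.add_ne_top.2 ⟨ENNReal.natCast_ne_top k, ENNReal.one_ne_top⟩
  have hlim : Tendsto (fun k : ℕ => ((k : ENNReal) + 1)⁻¹) atTop (𝓝 0) := by
    have := (tendsto_add_atTop_iff_nat 1).2 ENNReal.tendsto_inv_nat_nhds_zero
    simpa using this
  choose u hu h1 h2 using fun k : ℕ => h _ (hε k)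
  exact ⟨hf, hg, u, hu, tendsto_of_tendsto_of_tendsto_of_le_of_le tendsto_const_nhds hlim
    (fun _ => zero_le) h1, tendsto_of_tendsto_of_tendsto_of_le_of_le tendsto_const_nhds hlim
    (fun _ => zero_le) h2⟩

/-- The Sobolev space is closed under joint `L²` convergence of functions and gradients. -/
lemma MemSobolevA.of_tendsto {f : E n → ℝ} {g : E n → E n} {fk : ℕ → E n → ℝ}
    {gk : ℕ → E n → E n} (hf : MemLp f 2 (muW w)) (hg : MemLp g 2 (muW w))
    (hk : ∀ k, MemSobolevA w (fk k) (gk k))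
    (h1 : Tendsto (fun k => eLpNorm (fun x => fk k x - f x) 2 (muW w)) atTop (𝓝 0))
    (h2 : Tendsto (fun k => eLpNorm (fun x => gk k x - g x) 2 (muW w)) atTop (𝓝 0)) :
    MemSobolevA w f g := by
  refine .of_forall_lt hf hg fun ε hε => ?_
  have hε2 : 0 < ε / 2 := ENNReal.half_pos hε.ne'
  obtain ⟨k, hk1, hk2⟩ := ((h1.eventually_lt_const hε2).and (h2.eventually_lt_const hε2)).exists
  obtain ⟨u, huA, hu1, hu2⟩ := (hk k).approx
  obtain ⟨j, hj1, hj2⟩ :=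
    ((hu1.eventually_lt_const hε2).and (hu2.eventually_lt_const hε2)).exists
  have hum : AEStronglyMeasurable (u j) (muW w) :=
    (huA j).1.continuous.aestronglyMeasurable
  have hugm : AEStronglyMeasurable (gradient (u j)) (muW w) :=
    (continuous_gradient (huA j).1).aestronglyMeasurable
  refine ⟨u j, huA j, ?_, ?_⟩
  · have e : (fun x => u j x - f x) = (fun x => u j x - fk k x) + fun x => fk k x - f x := by
      ext x; simp
    rw [e]
    refine (eLpNorm_add_le (hum.sub (hk k).memLp_fun.1) ((hk k).memLp_fun.1.sub hf.1)
      one_le_two).trans ?_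
    calc _ ≤ ε / 2 + ε / 2 := add_le_add hj1.le hk1.le
      _ = ε := ENNReal.add_halves ε
  · have e : (fun x => gradient (u j) x - g x) =
        (fun x => gradient (u j) x - gk k x) + fun x => gk k x - g x := by
      ext1 x; simp
    rw [e]
    refine (eLpNorm_add_le (hugm.sub (hk k).memLp_grad.1) ((hk k).memLp_grad.1.sub hg.1)
      one_le_two).trans ?_
    calc _ ≤ ε / 2 + ε / 2 := add_le_add hj2.le hk2.le
      _ = ε := ENNReal.add_halves ε

lemma MemSobolevA.of_mem_classA [IsProbabilityMeasure (muW w)] {u : E n → ℝ}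
    (hu : u ∈ classA (posSet w)) : MemSobolevA w u (gradient u) :=
  ⟨memLp_of_compactSupport hu.1.continuous hu.2.1,
    memLp_of_compactSupport (continuous_gradient hu.1) (hasCompactSupport_gradient hu.2.1),
    fun _ => u, fun _ => hu, by simp, by simp⟩

lemma classA_add {S : Set (E n)} {u v : E n → ℝ} (hu : u ∈ classA S) (hv : v ∈ classA S) :
    (fun x => u x + v x) ∈ classA S := by
  refine ⟨hu.1.add hv.1, hu.2.1.add hv.2.1, fun x hx η hη => ?_⟩
  rw [gradient_add (differentiableAt_of_smooth hu.1) (differentiableAt_of_smooth hv.1),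
    inner_add_left, hu.2.2 x hx η hη, hv.2.2 x hx η hη, add_zero]

lemma zero_mem_classA {S : Set (E n)} : (fun _ => 0) ∈ classA S :=
  ⟨contDiff_const, HasCompactSupport.zero, fun x _ η _ => by simp⟩

lemma MemSobolevA.add {f f' : E n → ℝ} {g g' : E n → E n} (h : MemSobolevA w f g)
    (h' : MemSobolevA w f' g') :
    MemSobolevA w (fun x => f x + f' x) (fun x => g x + g' x) := by
  obtain ⟨u, huA, hu1, hu2⟩ := h.approx
  obtain ⟨v, hvA, hv1, hv2⟩ := h'.approx
  refine ⟨h.memLp_fun.add h'.memLp_fun, h.memLp_grad.add h'.memLp_grad,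
    fun k x => u k x + v k x, fun k => classA_add (huA k) (hvA k), ?_, ?_⟩
  · have := hu1.add hv1
    rw [add_zero] at this
    refine tendsto_of_tendsto_of_tendsto_of_le_of_le tendsto_const_nhds this
      (fun _ => zero_le) fun k => ?_
    have e : (fun x => u k x + v k x - (f x + f' x)) =
        (fun x => u k x - f x) + fun x => v k x - f' x := by
      ext x; simp; ring
    rw [e]
    exact eLpNorm_add_le ((huA k).1.continuous.aestronglyMeasurable.sub h.memLp_fun.1)
      ((hvA k).1.continuous.aestronglyMeasurable.sub h'.memLp_fun.1) one_le_two
  · have := hu2.add hv2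
    rw [add_zero] at this
    refine tendsto_of_tendsto_of_tendsto_of_le_of_le tendsto_const_nhds this
      (fun _ => zero_le) fun k => ?_
    have e : (fun x => gradient (fun x => u k x + v k x) x - (g x + g' x)) =
        (fun x => gradient (u k) x - g x) + fun x => gradient (v k) x - g' x := by
      ext1 x
      rw [gradient_add (differentiableAt_of_smooth (huA k).1)
        (differentiableAt_of_smooth (hvA k).1), Pi.add_apply]
      abel
    rw [e]
    exact eLpNorm_add_le ((continuous_gradient (huA k).1).aestronglyMeasurable.sub h.memLp_grad.1)
      ((continuous_gradient (hvA k).1).aestronglyMeasurable.sub h'.memLp_grad.1) one_le_two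

lemma MemSobolevA.sum [IsProbabilityMeasure (muW w)] {ι : Type*} (s : Finset ι)
    {f : ι → E n → ℝ} {g : ι → E n → E n} (h : ∀ i ∈ s, MemSobolevA w (f i) (g i)) :
    MemSobolevA w (fun x => ∑ i ∈ s, f i x) (fun x => ∑ i ∈ s, g i x) := by
  classical
  induction s using Finset.induction_on with
  | empty =>
    have := MemSobolevA.of_mem_classA (w := w) zero_mem_classA
    simpa using this
  | insert i s hi ih =>
    simp only [Finset.sum_insert hi]
    exact (h i (Finset.mem_insert_self i s)).add (ih fun j hj => h j (Finset.mem_insert_of_mem hj))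

/-- If all dilations `x ↦ χ (x / (k + 1))` of one cutoff function are Sobolev functions, so are
the constants. -/
lemma MemSobolevA.one_of_cutoff [IsProbabilityMeasure (muW w)] {χ : E n → ℝ}
    (hχ : ContDiff ℝ ∞ χ) (hc : HasCompactSupport χ) (h0 : χ 0 = 1)
    (h : ∀ k : ℕ, MemSobolevA w (fun x => χ (((k : ℝ) + 1)⁻¹ • x))
      (gradient fun x => χ (((k : ℝ) + 1)⁻¹ • x))) :
    MemSobolevA w (fun _ => 1) (fun _ => 0) := by
  obtain ⟨C, hC⟩ := hχ.continuous.bounded_above_of_compact_support hc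
  obtain ⟨D, hD⟩ := (continuous_gradient hχ).bounded_above_of_compact_support
    (hasCompactSupport_gradient hc)
  have hinv : Tendsto (fun k : ℕ => ((k : ℝ) + 1)⁻¹) atTop (𝓝 0) := by
    simpa using tendsto_one_div_add_atTop_nhds_zero_nat (𝕜 := ℝ)
  have hlt : ∀ k : ℕ, ((k : ℝ) + 1)⁻¹ ≤ 1 := fun k => inv_le_one_of_one_le₀ (by simp)
  have hgr : ∀ (k : ℕ) (x : E n), gradient (fun x => χ (((k : ℝ) + 1)⁻¹ • x)) x =
      ((k : ℝ) + 1)⁻¹ • gradient χ (((k : ℝ) + 1)⁻¹ • x) := fun k x =>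
    gradient_comp_smul (hχ.differentiable (by simp)) _ x
  refine MemSobolevA.of_tendsto (memLp_const 1) (memLp_const 0) h ?_ ?_
  · refine tendsto_eLpNorm_two_of_dominated (b := fun _ => C + 1) (fun k => ?_) (memLp_const _)
      (fun k => .of_forall fun x => ?_) (.of_forall fun x => ?_)
    · exact ((h k).memLp_fun.sub (memLp_const 1)).1
    · exact (norm_sub_le _ _).trans (by gcongr; exacts [hC _, by simp])
    · have h1 : Tendsto (fun k : ℕ => ((k : ℝ) + 1)⁻¹ • x) atTop (𝓝 0) := by
        simpa using hinv.smul_const x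
      have h2 := ((hχ.continuous.tendsto 0).comp h1).sub_const 1
      simpa [h0] using h2
  · refine tendsto_eLpNorm_two_of_dominated (b := fun _ => D) (fun k => ?_) (memLp_const _)
      (fun k => .of_forall fun x => ?_) (.of_forall fun x => ?_)
    · exact ((h k).memLp_grad.sub (memLp_const 0)).1
    · rw [hgr, sub_zero, norm_smul, Real.norm_of_nonneg (by positivity)]
      exact (mul_le_of_le_one_left (norm_nonneg _) (hlt k)).trans (hD _)
    · simp only [hgr, sub_zero]
      refine squeeze_zero_norm (a := fun k : ℕ => ((k : ℝ) + 1)⁻¹ * D) (fun k => ?_) ?_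
      · rw [norm_smul, Real.norm_of_nonneg (by positivity)]
        gcongr
        exact hD _
      · simpa using hinv.mul_const D

end WeightedGaussian

/-! ### Weights that do not depend on one coordinate -/

namespace WeightedGaussian

variable {n : ℕ} {w : E n → ℝ} {i : Fin n}

lemma hessBound_le_zero_of_indep (hne : (posSet w).Nonempty) (hi : IndepOfCoord w i) {K : ℝ}
    (hK : HessBound w K) : K ≤ 0 := by
  obtain ⟨x, hx⟩ := hne
  set e : E n := EuclideanSpace.single i 1 with he
  set F : E n → ℝ := fun y => Real.log (w y) with hF
  have h1 : ∀ t : ℝ, fderiv ℝ F (x + t • e) = fderiv ℝ F x := fun t => by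
    rw [← fderiv_comp_add_right]
    simp only [hF, he, hi _ t]
  have h2 : fderiv ℝ (fderiv ℝ F) x e = 0 := by
    by_cases hd : DifferentiableAt ℝ (fderiv ℝ F) x
    · have hline : HasDerivAt (fun t : ℝ => x + t • e) e 0 := by
        simpa using ((hasDerivAt_id (0 : ℝ)).smul_const e).const_add x
      have hd' : HasFDerivAt (fderiv ℝ F) (fderiv ℝ (fderiv ℝ F) x) (x + (0 : ℝ) • e) := by
        simpa using hd.hasFDerivAt
      have h3 := hd'.comp_hasDerivAt (0 : ℝ) hline
      have h4 : fderiv ℝ F ∘ (fun t : ℝ => x + t • e) = fun _ => fderiv ℝ F x := funext h1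
      rw [h4] at h3
      exact h3.unique (hasDerivAt_const _ _)
    · simp [fderiv_zero_of_not_differentiableAt hd]
  have h3 := hK x hx e
  rw [h2] at h3
  simpa [he] using h3

lemma Kw_le_zero_of_indep (hw : IsAdmissible w) (hi : IndepOfCoord w i) : Kw w ≤ 0 := by
  obtain ⟨K, _, hK⟩ := hw.hess
  exact csSup_le ⟨K, hK⟩ fun K' hK' => hessBound_le_zero_of_indep hw.nonempty hi hK'

/-- Exponential tilting in an invariant direction is a translation of the density. -/
lemma dens_mul_exp (hi : IndepOfCoord w i) (c : ℝ) (x : E n) :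
    dens w x * Real.exp (c * x i) =
      Real.exp (c ^ 2 / 2) * dens w (x - c • EuclideanSpace.single i (1 : ℝ)) := by
  have h1 : w (x - c • EuclideanSpace.single i (1 : ℝ)) = w x := by
    rw [sub_eq_add_neg, ← neg_smul]
    exact hi x (-c)
  have h2 : ‖x - c • EuclideanSpace.single i (1 : ℝ)‖ ^ 2 = ‖x‖ ^ 2 - 2 * c * x i + c ^ 2 := by
    rw [norm_sub_sq_real, norm_smul, real_inner_smul_right, EuclideanSpace.inner_single_right]
    simp
    ring
  rw [dens, dens, h1, h2, mul_assoc, ← Real.exp_add, mul_left_comm, ← Real.exp_add]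
  congr 2
  ring

lemma measurable_coord (i : Fin n) : Measurable fun x : E n => x i :=
  (EuclideanSpace.proj (𝕜 := ℝ) i).continuous.measurable

lemma lintegral_exp_coord (hw : IsAdmissible w) (hi : IndepOfCoord w i) (c : ℝ) :
    ∫⁻ x, ENNReal.ofReal (Real.exp (c * x i)) ∂muW w = ENNReal.ofReal (Real.exp (c ^ 2 / 2)) := by
  have hm := measurable_coord i
  rw [hw.lintegral_muW (by fun_prop)]
  simp only [← ENNReal.ofReal_mul (hw.dens_nonneg _), dens_mul_exp hi,
    ENNReal.ofReal_mul (Real.exp_pos _).le]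
  rw [lintegral_const_mul' _ _ ENNReal.ofReal_ne_top,
    lintegral_sub_right_eq_self (fun x => ENNReal.ofReal (dens w x)), ← hw.preMeasure_univ,
    mul_left_comm, ENNReal.inv_mul_cancel hw.preMeasure_univ_ne_zero hw.preMeasure_univ_ne_top,
    mul_one]

lemma integrable_exp_coord (hw : IsAdmissible w) (hi : IndepOfCoord w i) (c : ℝ) :
    Integrable (fun x => Real.exp (c * x i)) (muW w) := by
  have hm := measurable_coord i
  refine ⟨by fun_prop, ?_⟩
  rw [hasFiniteIntegral_iff_ofReal (.of_forall fun x => (Real.exp_pos _).le),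
    lintegral_exp_coord hw hi]
  exact ENNReal.ofReal_lt_top

/-- The `i`-th coordinate has the exponential moments of a standard Gaussian variable. -/
lemma mgf_coord (hw : IsAdmissible w) (hi : IndepOfCoord w i) (c : ℝ) :
    ProbabilityTheory.mgf (fun x : E n => x i) (muW w) c = Real.exp (c ^ 2 / 2) := by
  rw [ProbabilityTheory.mgf, integral_eq_lintegral_of_nonneg_ae
    (.of_forall fun x => (Real.exp_pos _).le) (integrable_exp_coord hw hi c).1,
    lintegral_exp_coord hw hi, ENNReal.toReal_ofReal (Real.exp_pos _).le]

lemma integral_coord_mul_exp (hw : IsAdmissible w) (hi : IndepOfCoord w i) (c : ℝ) :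
    ∫ x, x i * Real.exp (c * x i) ∂muW w = c * Real.exp (c ^ 2 / 2) := by
  have hmem : c ∈ interior (ProbabilityTheory.integrableExpSet (fun x : E n => x i) (muW w)) := by
    have : ProbabilityTheory.integrableExpSet (fun x : E n => x i) (muW w) = Set.univ :=
      Set.eq_univ_of_forall fun c => integrable_exp_coord hw hi c
    simp [this]
  have h1 := ProbabilityTheory.hasDerivAt_mgf hmem
  have e : ProbabilityTheory.mgf (fun x : E n => x i) (muW w) =
      fun c => Real.exp (c ^ 2 / 2) := funext (mgf_coord hw hi)
  rw [e] at h1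
  have h2 := ((hasDerivAt_pow 2 c).div_const 2).exp
  rw [h1.unique h2]
  norm_num
  ring

lemma gradient_comp_coord {ψ : ℝ → ℝ} {x : E n} (hψ : DifferentiableAt ℝ ψ (x i)) :
    gradient (fun y : E n => ψ (y i)) x =
      deriv ψ (x i) • EuclideanSpace.single i (1 : ℝ) := by
  have hc : HasFDerivAt (fun y : E n => y i) (EuclideanSpace.proj (𝕜 := ℝ) i) x :=
    (EuclideanSpace.proj (𝕜 := ℝ) i).hasFDerivAt
  rw [gradient_comp (u := fun y : E n => y i) hψ hc.differentiableAt]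
  congr 1
  refine ext_inner_right ℝ fun v => ?_
  rw [inner_gradient_left, hc.fderiv, EuclideanSpace.inner_single_left]
  simp

lemma deriv_exp_mul (b t : ℝ) : deriv (fun t => Real.exp (b * t)) t = b * Real.exp (b * t) := by
  have := ((hasDerivAt_id t).const_mul b).exp.deriv
  simpa [mul_comm] using this

lemma gradient_exp_coord (b : ℝ) (x : E n) :
    gradient (fun y : E n => Real.exp (b * y i)) x =
      (b * Real.exp (b * x i)) • EuclideanSpace.single i (1 : ℝ) := by
  rw [gradient_comp_coord (ψ := fun t => Real.exp (b * t)) (by fun_prop), deriv_exp_mul]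

lemma exp_mul_sq (b t : ℝ) : Real.exp (b * t) ^ 2 = Real.exp (2 * b * t) := by
  rw [← Real.exp_nat_mul]
  congr 1
  push_cast
  ring

lemma integral_norm_gradient_exp (hw : IsAdmissible w) (hi : IndepOfCoord w i) (b : ℝ) :
    ∫ x, ‖gradient (fun y : E n => Real.exp (b * y i)) x‖ ^ 2 ∂muW w =
      b ^ 2 * Real.exp (2 * b ^ 2) := by
  have h : ∀ x : E n, ‖gradient (fun y : E n => Real.exp (b * y i)) x‖ ^ 2 =
      b ^ 2 * Real.exp (2 * b * x i) := fun x => by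
    rw [gradient_exp_coord, norm_smul, mul_pow, Real.norm_eq_abs, sq_abs, mul_pow, exp_mul_sq]
    simp
  simp only [h]
  rw [integral_const_mul]
  have := mgf_coord hw hi (2 * b)
  rw [ProbabilityTheory.mgf] at this
  rw [this]
  congr 2
  ring

lemma ent_exp_coord (hw : IsAdmissible w) (hi : IndepOfCoord w i) (b : ℝ) :
    Ent (muW w) (fun x => Real.exp (b * x i) ^ 2) =
      2 * ∫ x, ‖gradient (fun y : E n => Real.exp (b * y i)) x‖ ^ 2 ∂muW w := by
  rw [integral_norm_gradient_exp hw hi]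
  have h1 := mgf_coord hw hi (2 * b)
  rw [ProbabilityTheory.mgf] at h1
  have h2 := integral_coord_mul_exp hw hi (2 * b)
  have e : ∀ x : E n, Real.exp (2 * b * x i) * (2 * b * x i) =
      2 * b * (x i * Real.exp (2 * b * x i)) := fun x => by ring
  simp only [Ent, exp_mul_sq, Real.log_exp, e]
  rw [integral_const_mul, h1, h2, Real.log_exp]
  have e2 : (2 * b) ^ 2 / 2 = 2 * b ^ 2 := by ring
  rw [e2]
  ring

/-- The domain is invariant under translation in direction `i`, so its normals have no `i`-th
component. -/
lemma IsOuterNormal.coord_eq_zero (hne : (posSet w).Nonempty) (hi : IndepOfCoord w i)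
    {x η : E n} (hη : IsOuterNormal (posSet w) x η) : η i = 0 := by
  obtain ⟨y, hy⟩ := hne
  have h : ∀ t : ℝ, ⟪η, y - x⟫ + t * η i ≤ 0 := by
    intro t
    have hmem : y + t • EuclideanSpace.single i (1 : ℝ) ∈ posSet w := by
      change 0 < w _
      rw [hi y t]
      exact hy
    have := hη.2 _ hmem
    rw [add_sub_right_comm, inner_add_right, real_inner_smul_right,
      EuclideanSpace.inner_single_right] at this
    simpa using this
  by_contra hne
  have := h ((1 - ⟪η, y - x⟫) / η i)
  rw [div_mul_cancel₀ _ hne] at this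
  linarith

lemma contDiff_coord (i : Fin n) : ContDiff ℝ ∞ fun x : E n => x i :=
  (EuclideanSpace.proj (𝕜 := ℝ) i).contDiff

/-- Multiplication by a function of the `i`-th coordinate preserves the Neumann condition, so the
approximants of `1` yield approximants of `ψ (x i)`. -/
lemma memSobolevA_comp_coord (hw : IsAdmissible w) (hi : IndepOfCoord w i)
    (h : MemSobolevA w (fun _ => 1) (fun _ => 0)) {ψ : ℝ → ℝ} (hψ : ContDiff ℝ ∞ ψ)
    (hc : HasCompactSupport ψ) :
    MemSobolevA w (fun x => ψ (x i))
      (fun x => deriv ψ (x i) • EuclideanSpace.single i (1 : ℝ)) := by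
  have := hw.isProbabilityMeasure
  obtain ⟨u, huA, hu1, hu2⟩ := h.approx
  have hψ' : Continuous (deriv ψ) := hψ.continuous_deriv (by simp)
  obtain ⟨C, hC⟩ := hψ.continuous.bounded_above_of_compact_support hc
  obtain ⟨D, hD⟩ := hψ'.bounded_above_of_compact_support hc.deriv
  have hcoord := contDiff_coord i
  have hcc := hcoord.continuous
  have hψi : ContDiff ℝ ∞ fun x : E n => ψ (x i) := hψ.comp hcoord
  have hCD : ∀ {B : ℝ}, B ≤ max C D → ∀ {a : ℝ}, 0 ≤ a → B * a ≤ max C D * a := fun hB _ ha =>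
    mul_le_mul_of_nonneg_right hB ha
  have hgr : ∀ k x, gradient (fun x => ψ (x i) * u k x) x =
      ψ (x i) • gradient (u k) x + u k x • deriv ψ (x i) • EuclideanSpace.single i (1 : ℝ) := by
    intro k x
    rw [gradient_mul (differentiableAt_of_smooth hψi) (differentiableAt_of_smooth (huA k).1),
      gradient_comp_coord (hψ.differentiable (by simp) _)]
  refine ⟨?_, ?_, fun k x => ψ (x i) * u k x, fun k => ⟨hψi.mul (huA k).1, (huA k).2.1.mul_left,
    fun x hx η hη => ?_⟩, ?_, ?_⟩
  · exact MemLp.of_bound hψi.continuous.aestronglyMeasurable C (.of_forall fun x => hC _)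
  · refine MemLp.of_bound (Continuous.aestronglyMeasurable (by fun_prop)) D
      (.of_forall fun x => ?_)
    rw [norm_smul]
    simpa using hD (x i)
  · rw [hgr, inner_add_left, real_inner_smul_left, (huA k).2.2 x hx η hη, real_inner_smul_left,
      real_inner_smul_left, EuclideanSpace.inner_single_left,
      hη.coord_eq_zero hw.nonempty hi]
    simp
  · have hlim := ENNReal.Tendsto.const_mul (a := ENNReal.ofReal C) hu1
      (Or.inr ENNReal.ofReal_ne_top)
    rw [mul_zero] at hlim
    refine tendsto_of_tendsto_of_tendsto_of_le_of_le tendsto_const_nhds hlim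
      (fun _ => zero_le) fun k => ?_
    refine eLpNorm_le_mul_eLpNorm_of_ae_le_mul (.of_forall fun x => ?_) 2
    rw [← mul_sub_one, norm_mul]
    gcongr
    exact hC _
  · have hlim := ENNReal.Tendsto.const_mul (a := ENNReal.ofReal (max C D)) (hu2.add hu1)
      (Or.inr ENNReal.ofReal_ne_top)
    rw [add_zero, mul_zero] at hlim
    refine tendsto_of_tendsto_of_tendsto_of_le_of_le tendsto_const_nhds hlim
      (fun _ => zero_le) fun k => ?_
    refine eLpNorm_le_add_of_norm_le
      (((continuous_gradient (huA k).1).aestronglyMeasurable).sub aestronglyMeasurable_const)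
      (((huA k).1.continuous.aestronglyMeasurable).sub aestronglyMeasurable_const) fun x => ?_
    have e : gradient (fun x => ψ (x i) * u k x) x -
        deriv ψ (x i) • EuclideanSpace.single i (1 : ℝ) = ψ (x i) • (gradient (u k) x - 0) +
          (u k x - 1) • deriv ψ (x i) • EuclideanSpace.single i (1 : ℝ) := by
      rw [hgr]; module
    rw [e, mul_add]
    refine (norm_add_le _ _).trans (add_le_add ?_ ?_)
    · rw [norm_smul]
      gcongr
      exact (hC _).trans (le_max_left _ _)
    · rw [norm_smul, norm_smul, mul_comm (max C D)]
      gcongr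
      simpa using (hD (x i)).trans (le_max_right _ _)

/-- A smooth cutoff function on the line. -/
lemma exists_cutoff : ∃ χ : ℝ → ℝ, ContDiff ℝ ∞ χ ∧ HasCompactSupport χ ∧ χ 0 = 1 ∧
    ∀ t, |χ t| ≤ 1 := by
  let B : ContDiffBump (0 : ℝ) := ⟨1, 2, one_pos, one_lt_two⟩
  refine ⟨B, B.contDiff, B.hasCompactSupport, B.one_of_mem_closedBall (by simp [B]), fun t => ?_⟩
  rw [abs_of_nonneg B.nonneg]
  exact B.le_one

lemma memSobolevA_exp_coord (hw : IsAdmissible w) (hi : IndepOfCoord w i)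
    (h : MemSobolevA w (fun _ => 1) (fun _ => 0)) (b : ℝ) :
    MemSobolevA w (fun x => Real.exp (b * x i)) (gradient fun x => Real.exp (b * x i)) := by
  have := hw.isProbabilityMeasure
  obtain ⟨χ, hχ, hχc, hχ0, hχ1⟩ := exists_cutoff
  obtain ⟨D, hD⟩ := (hχ.continuous_deriv (by simp)).bounded_above_of_compact_support hχc.deriv
  have hD0 : 0 ≤ D := (norm_nonneg _).trans (hD 0)
  have hm := measurable_coord i
  have hinv : Tendsto (fun k : ℕ => ((k : ℝ) + 1)⁻¹) atTop (𝓝 0) := by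
    simpa using tendsto_one_div_add_atTop_nhds_zero_nat (𝕜 := ℝ)
  have hlt : ∀ k : ℕ, ((k : ℝ) + 1)⁻¹ ≤ 1 := fun k => inv_le_one_of_one_le₀ (by simp)
  have hg : (gradient fun x : E n => Real.exp (b * x i)) =
      fun x => (b * Real.exp (b * x i)) • EuclideanSpace.single i (1 : ℝ) :=
    funext fun x => gradient_exp_coord b x
  have hmem : MemLp (fun x : E n => Real.exp (b * x i)) 2 (muW w) := by
    rw [memLp_two_iff_integrable_sq (by fun_prop)]
    simpa only [exp_mul_sq] using integrable_exp_coord hw hi (2 * b)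
  set ψ : ℕ → ℝ → ℝ := fun k t => χ (((k : ℝ) + 1)⁻¹ * t) * Real.exp (b * t) with hψ
  have hψs : ∀ k, ContDiff ℝ ∞ (ψ k) := fun k => by
    simp only [hψ]
    fun_prop
  have hψc : ∀ k, HasCompactSupport (ψ k) := fun k => by
    have : HasCompactSupport fun t : ℝ => χ (((k : ℝ) + 1)⁻¹ • t) :=
      hχc.comp_smul (by positivity)
    exact this.mul_right
  have hψd : ∀ k t, deriv (ψ k) t = ((k : ℝ) + 1)⁻¹ * deriv χ (((k : ℝ) + 1)⁻¹ * t) *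
      Real.exp (b * t) + χ (((k : ℝ) + 1)⁻¹ * t) * (b * Real.exp (b * t)) := by
    intro k t
    have h1 : HasDerivAt (fun t : ℝ => χ (((k : ℝ) + 1)⁻¹ * t))
        (((k : ℝ) + 1)⁻¹ * deriv χ (((k : ℝ) + 1)⁻¹ * t)) t := by
      have h0 := ((hχ.differentiable (by simp)) (((k : ℝ) + 1)⁻¹ * t)).hasDerivAt
      have := h0.comp t ((hasDerivAt_id t).const_mul (((k : ℝ) + 1)⁻¹))
      rw [mul_one, mul_comm] at this
      exact this
    have h2 : HasDerivAt (fun t : ℝ => Real.exp (b * t)) (b * Real.exp (b * t)) t := by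
      simpa [mul_comm] using ((hasDerivAt_id t).const_mul b).exp
    exact (h1.mul h2).deriv
  have hχlim : ∀ t : ℝ, Tendsto (fun k : ℕ => χ (((k : ℝ) + 1)⁻¹ * t)) atTop (𝓝 1) := fun t => by
    have h1 : Tendsto (fun k : ℕ => ((k : ℝ) + 1)⁻¹ * t) atTop (𝓝 0) := by
      simpa using hinv.mul_const t
    have h2 := (hχ.continuous.tendsto 0).comp h1
    rwa [hχ0] at h2
  have hk := fun k => memSobolevA_comp_coord hw hi h (hψs k) (hψc k)
  refine .of_tendsto hmem (hg ▸ ?_) hk ?_ ?_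
  · refine (hmem.const_mul b).of_le_mul (c := 1) (Measurable.aestronglyMeasurable (by fun_prop))
      (.of_forall fun x => ?_)
    rw [norm_smul]
    simp
  · refine tendsto_eLpNorm_two_of_dominated (b := fun x => 2 * Real.exp (b * x i))
      (fun k => ((hk k).memLp_fun.sub hmem).1) (hmem.const_mul 2)
      (fun k => .of_forall fun x => ?_) (.of_forall fun x => ?_)
    · rw [hψ, ← sub_one_mul, norm_mul, Real.norm_of_nonneg (Real.exp_pos _).le]
      gcongr
      refine (norm_sub_le _ _).trans ?_
      have := hχ1 (((k : ℝ) + 1)⁻¹ * x i)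
      rw [Real.norm_eq_abs, norm_one]
      linarith
    · have := ((hχlim (x i)).mul_const (Real.exp (b * x i))).sub_const (Real.exp (b * x i))
      simpa [hψ] using this
  · rw [hg]
    have e : ∀ k (x : E n), deriv (ψ k) (x i) • EuclideanSpace.single i (1 : ℝ) -
        (b * Real.exp (b * x i)) • EuclideanSpace.single i (1 : ℝ) =
        ((((k : ℝ) + 1)⁻¹ * deriv χ (((k : ℝ) + 1)⁻¹ * x i) +
          (χ (((k : ℝ) + 1)⁻¹ * x i) - 1) * b) * Real.exp (b * x i)) •
          (EuclideanSpace.single i (1 : ℝ) : E n) := by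
      intro k x
      rw [hψd, ← sub_smul]
      congr 1
      ring
    refine tendsto_eLpNorm_two_of_dominated
      (b := fun x => (D + 2 * |b|) * Real.exp (b * x i)) (fun k => ?_)
      (hmem.const_mul _) (fun k => .of_forall fun x => ?_) (.of_forall fun x => ?_)
    · refine ((hk k).memLp_grad.1).sub (Measurable.aestronglyMeasurable (by fun_prop))
    · rw [e, norm_smul, norm_mul, Real.norm_of_nonneg (Real.exp_pos _).le]
      simp only [PiLp.norm_single, norm_one, mul_one]
      gcongr
      refine (norm_add_le _ _).trans (add_le_add ?_ ?_)
      · rw [norm_mul, Real.norm_of_nonneg (by positivity)]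
        exact (mul_le_of_le_one_left (norm_nonneg _) (hlt k)).trans (hD _)
      · rw [norm_mul, Real.norm_eq_abs b]
        gcongr
        refine (norm_sub_le _ _).trans ?_
        have := hχ1 (((k : ℝ) + 1)⁻¹ * x i)
        rw [Real.norm_eq_abs, norm_one]
        linarith
    · simp only [e]
      have h1 : Tendsto (fun k : ℕ => ((k : ℝ) + 1)⁻¹ * deriv χ (((k : ℝ) + 1)⁻¹ * x i)) atTop
          (𝓝 0) := by
        refine squeeze_zero_norm (a := fun k : ℕ => ((k : ℝ) + 1)⁻¹ * D) (fun k => ?_) ?_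
        · rw [norm_mul, Real.norm_of_nonneg (by positivity)]
          gcongr
          exact hD _
        · simpa using hinv.mul_const D
      have h2 := ((hχlim (x i)).sub_const 1).mul_const b
      have h3 := ((h1.add h2).mul_const (Real.exp (b * x i))).smul_const
        (EuclideanSpace.single i (1 : ℝ) : E n)
      simpa using h3

end WeightedGaussian

/-! ### Constants in the Sobolev space: cones -/

namespace WeightedGaussian

variable {n : ℕ} {w : E n → ℝ}

lemma exists_radial_cutoff (n : ℕ) : ∃ χ : E n → ℝ, ContDiff ℝ ∞ χ ∧ HasCompactSupport χ ∧
    χ 0 = 1 ∧ ∀ x η : E n, ⟪η, x⟫ = 0 → ⟪gradient χ x, η⟫ = 0 := by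
  obtain ⟨χ, hχ, hχc, hχ0, -⟩ := exists_cutoff
  obtain ⟨R, hR⟩ := hχc.isCompact.isBounded.subset_closedBall 0
  have hsq : ContDiff ℝ ∞ fun x : E n => ‖x‖ ^ 2 := contDiff_norm_sq ℝ
  refine ⟨fun x => χ (‖x‖ ^ 2), hχ.comp hsq, ?_, by simpa using hχ0, fun x η h => ?_⟩
  · refine HasCompactSupport.intro (isCompact_closedBall (0 : E n) (|R| + 1)) fun x hx => ?_
    refine image_eq_zero_of_notMem_tsupport fun hmem => ?_
    have h1 := hR hmem
    rw [mem_closedBall_zero_iff, Real.norm_of_nonneg (by positivity)] at h1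
    rw [mem_closedBall_zero_iff, not_le] at hx
    have := le_abs_self R
    have := abs_nonneg R
    nlinarith
  · rw [gradient_comp (u := fun x : E n => ‖x‖ ^ 2) (hχ.differentiable (by simp) _)
      (hsq.differentiable (by simp) _), real_inner_smul_left, inner_gradient_left]
    have : fderiv ℝ (fun x : E n => ‖x‖ ^ 2) x η = 2 * ⟪x, η⟫ := by
      rw [(hasStrictFDerivAt_norm_sq x).hasFDerivAt.fderiv]
      simp
    rw [this, real_inner_comm, h]
    simp

lemma IsOuterNormal.inner_le_of_mem_closure {S : Set (E n)} {x η y : E n}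
    (hη : IsOuterNormal S x η) (hy : y ∈ closure S) : ⟪η, y - x⟫ ≤ 0 := by
  have hcl : IsClosed {y : E n | ⟪η, y - x⟫ ≤ 0} :=
    isClosed_le (by fun_prop) continuous_const
  exact closure_minimal hη.2 hcl hy

/-- The normals of a cone are orthogonal to the position vector. -/
lemma IsOuterNormal.inner_eq_zero_of_isCone {S : Set (E n)} (hS : IsCone S) {x η : E n}
    (hx : x ∈ frontier S) (hη : IsOuterNormal S x η) : ⟪η, x⟫ = 0 := by
  have hmem : ∀ t : ℝ, 0 < t → t • x ∈ closure S := fun t ht =>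
    map_mem_closure (continuous_const_smul t) hx.1 fun y hy => hS t ht y hy
  have h1 := hη.inner_le_of_mem_closure (hmem 2 two_pos)
  have h2 := hη.inner_le_of_mem_closure (hmem (1 / 2) one_half_pos)
  rw [inner_sub_right, real_inner_smul_right] at h1 h2
  linarith

lemma memSobolevA_one_of_isCone (hw : IsAdmissible w) (hS : IsCone (posSet w)) :
    MemSobolevA w (fun _ => 1) (fun _ => 0) := by
  have := hw.isProbabilityMeasure
  obtain ⟨χ, hχ, hχc, hχ0, hχg⟩ := exists_radial_cutoff n
  refine .one_of_cutoff hχ hχc hχ0 fun k => .of_mem_classA ⟨by fun_prop,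
    hχc.comp_smul (by positivity), fun x hx η hη => ?_⟩
  rw [gradient_comp_smul (hχ.differentiable (by simp)), real_inner_smul_left, hχg, mul_zero]
  rw [real_inner_smul_right, hη.inner_eq_zero_of_isCone hS hx, mul_zero]

/-! ### Constants in the Sobolev space: smooth boundary -/

lemma contDiff_gradient {u : E n → ℝ} (hu : ContDiff ℝ ∞ u) : ContDiff ℝ ∞ (gradient u) :=
  (InnerProductSpace.toDual ℝ (E n)).symm.contDiff.comp (hu.fderiv_right (by simp))

lemma gradient_eq_zero_of_notMem_tsupport {u : E n → ℝ} {x : E n} (hx : x ∉ tsupport u) :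
    gradient u x = 0 := by
  have : fderiv ℝ u x = 0 := by
    by_contra h
    exact hx (support_fderiv_subset ℝ h)
  simp [gradient, this]

/-- A defining function vanishes on the boundary. -/
lemma eq_zero_of_mem_frontier {S U : Set (E n)} (hS : IsOpen S) (hU : IsOpen U) {ρ : E n → ℝ}
    (hρ : Continuous ρ) (hUρ : ∀ y ∈ U, (y ∈ S ↔ ρ y < 0)) {x : E n} (hxU : x ∈ U)
    (hx : x ∈ frontier S) : ρ x = 0 := by
  rw [hS.frontier_eq] at hx
  refine le_antisymm (not_lt.1 fun hpos => ?_) (not_lt.1 fun h => hx.2 ((hUρ x hxU).2 h))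
  have hV : IsOpen (U ∩ {y | 0 < ρ y}) := hU.inter (isOpen_lt continuous_const hρ)
  obtain ⟨y, ⟨hyU, hy⟩, hyS⟩ := mem_closure_iff.1 hx.1 _ hV ⟨hxU, hpos⟩
  exact lt_asymm hy ((hUρ y hyU).1 hyS)

/-- The outer normals at a boundary point are multiples of the gradient of a defining function, in
the form that they are orthogonal to its orthogonal complement. -/
lemma IsOuterNormal.inner_eq_zero_of_orthogonal {S U : Set (E n)} (hU : IsOpen U) {ρ : E n → ℝ}
    (hρ : Differentiable ℝ ρ) (hUρ : ∀ y ∈ U, (y ∈ S ↔ ρ y < 0)) {x η v : E n} (hxU : x ∈ U)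
    (hx : ρ x = 0) (hρx : gradient ρ x ≠ 0) (hη : IsOuterNormal S x η)
    (hv : ⟪gradient ρ x, v⟫ = 0) : ⟪v, η⟫ = 0 := by
  -- directions along which `ρ` decreases point into the domain
  have hin : ∀ v : E n, ⟪gradient ρ x, v⟫ < 0 → ⟪η, v⟫ ≤ 0 := by
    intro v hv
    have hline : HasDerivAt (fun t : ℝ => x + t • v) v 0 := by
      simpa using ((hasDerivAt_id (0 : ℝ)).smul_const v).const_add x
    have hρ' : HasFDerivAt ρ (fderiv ℝ ρ x) (x + (0 : ℝ) • v) := by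
      simpa using (hρ x).hasFDerivAt
    have hd := hρ'.comp_hasDerivAt (0 : ℝ) hline
    rw [← inner_gradient_left] at hd
    have h1 := (hasDerivWithinAt_iff_tendsto_slope' (s := Set.Ioi (0 : ℝ)) (by simp)).1
      hd.hasDerivWithinAt
    have h2 : ∀ᶠ t : ℝ in 𝓝[>] 0, x + t • v ∈ U := by
      have : Tendsto (fun t : ℝ => x + t • v) (𝓝[>] 0) (𝓝 x) := by
        have := hline.continuousAt.tendsto
        simp only [zero_smul, add_zero] at this
        exact this.mono_left nhdsWithin_le_nhds
      exact this.eventually (hU.mem_nhds hxU)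
    obtain ⟨t, ht1, htU, ht0⟩ := ((h1.eventually_lt_const hv).and
      (h2.and self_mem_nhdsWithin)).exists
    have ht0' : 0 < t := ht0
    rw [slope_def_field, sub_zero, div_lt_iff₀ ht0', zero_mul] at ht1
    simp only [Function.comp, zero_smul, add_zero, hx, sub_zero] at ht1
    have := hη.2 _ ((hUρ _ htU).2 ht1)
    rw [add_sub_cancel_left, real_inner_smul_right] at this
    exact nonpos_of_mul_nonpos_right this ht0'
  set N := gradient ρ x
  have hle : ∀ v : E n, ⟪N, v⟫ = 0 → ⟪η, v⟫ ≤ 0 := by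
    intro v hv
    have hlim : Tendsto (fun ε : ℝ => ⟪η, v - ε • N⟫) (𝓝[>] 0) (𝓝 ⟪η, v - (0 : ℝ) • N⟫) :=
      (Continuous.tendsto (by fun_prop) _).mono_left nhdsWithin_le_nhds
    rw [zero_smul, sub_zero] at hlim
    refine le_of_tendsto hlim ?_
    filter_upwards [self_mem_nhdsWithin] with ε (hε : 0 < ε)
    refine hin _ ?_
    rw [inner_sub_right, hv, real_inner_smul_right, real_inner_self_eq_norm_sq, zero_sub,
      neg_lt_zero]
    have := norm_pos_iff.2 hρx
    positivity
  rw [real_inner_comm]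
  refine le_antisymm (hle v hv) ?_
  have := hle (-v) (by rw [inner_neg_right, hv, neg_zero])
  rw [inner_neg_right] at this
  linarith

/-- Near a boundary point with defining function `ρ`, a test function `h` is corrected to satisfy
the Neumann condition by subtracting `c θ(ρ)`, where `c` makes `∇h - c ∇ρ` tangential and `θ` has
slope one at zero and lives in a thin layer. The correction is bounded in `W^{1,∞}` and tends to
zero off the boundary as the layer shrinks. -/
lemma memSobolevA_of_tsupport_subset (hw : IsAdmissible w) {U : Set (E n)} (hU : IsOpen U)
    {ρ : E n → ℝ} (hρ : ContDiff ℝ ∞ ρ) (hUρ : ∀ y ∈ U, (y ∈ posSet w ↔ ρ y < 0))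
    (hU0 : ∀ y ∈ U, gradient ρ y ≠ 0) {h : E n → ℝ} (hh : ContDiff ℝ ∞ h)
    (hhc : HasCompactSupport h) (hhU : tsupport h ⊆ U) : MemSobolevA w h (gradient h) := by
  have := hw.isProbabilityMeasure
  set c : E n → ℝ := fun x => ⟪gradient h x, gradient ρ x⟫ / ‖gradient ρ x‖ ^ 2 with hc_def
  have hgh := contDiff_gradient hh
  have hgρ := contDiff_gradient hρ
  have hc0 : ∀ x, x ∉ tsupport h → c x = 0 := fun x hx => by
    simp [hc_def, gradient_eq_zero_of_notMem_tsupport hx]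
  have hcsub : tsupport c ⊆ tsupport h :=
    closure_minimal (fun x hx => by_contra fun hxh => hx (hc0 x hxh)) (isClosed_tsupport h)
  have hcc : HasCompactSupport c := hhc.isCompact.of_isClosed_subset (isClosed_tsupport c) hcsub
  have hc : ContDiff ℝ ∞ c := by
    rw [contDiff_iff_contDiffAt]
    intro x
    by_cases hx : x ∈ tsupport h
    · have hne : ‖gradient ρ x‖ ^ 2 ≠ 0 := by
        have := norm_pos_iff.2 (hU0 x (hhU hx))
        positivity
      exact (hgh.inner ℝ hgρ).contDiffAt.div (hgρ.norm_sq ℝ).contDiffAt hne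
    · have : c =ᶠ[𝓝 x] fun _ => 0 := by
        filter_upwards [(isClosed_tsupport h).isOpen_compl.mem_nhds hx] with y hy using hc0 y hy
      exact contDiffAt_const.congr_of_eventuallyEq this
  obtain ⟨χ, hχ, hχc, hχ0, -⟩ := exists_cutoff
  set θ : ℝ → ℝ := fun s => s * χ s with hθ_def
  have hθ : ContDiff ℝ ∞ θ := contDiff_id.mul hχ
  have hθc : HasCompactSupport θ := hχc.mul_left
  have hθ0 : θ 0 = 0 := by simp [hθ_def]
  have hθ' : deriv θ 0 = 1 := by
    have := ((hasDerivAt_id (0 : ℝ)).mul (hχ.differentiable (by simp) 0).hasDerivAt).deriv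
    simp only [hχ0, one_mul, id, zero_mul, add_zero] at this
    exact this
  have hθcont := hθ.continuous_deriv (by simp)
  obtain ⟨A, hA⟩ := hθ.continuous.bounded_above_of_compact_support hθc
  obtain ⟨A', hA'⟩ := hθcont.bounded_above_of_compact_support hθc.deriv
  have hA0 : 0 ≤ A := (norm_nonneg _).trans (hA 0)
  have hgc := continuous_gradient hc
  have hgρc := hgρ.continuous
  obtain ⟨B, hB⟩ := hc.continuous.bounded_above_of_compact_support hcc
  obtain ⟨B', hB'⟩ := hgc.bounded_above_of_compact_support (hasCompactSupport_gradient hcc)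
  obtain ⟨B'', hB''⟩ := (hc.continuous.smul hgρc).bounded_above_of_compact_support
    (hcc.smul_right (f' := gradient ρ))
  have hB0 : 0 ≤ B := (norm_nonneg _).trans (hB 0)
  have hB'0 : 0 ≤ B' := (norm_nonneg _).trans (hB' 0)
  have hB''0 : 0 ≤ B'' := (norm_nonneg _).trans (hB'' 0)
  -- the layer has thickness of order `1 / (k + 1)`
  set θk : ℕ → ℝ → ℝ := fun k s => ((k : ℝ) + 1)⁻¹ * θ (((k : ℝ) + 1) * s) with hθk_def
  have hθk : ∀ k, ContDiff ℝ ∞ (θk k) := fun k => by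
    simp only [hθk_def]
    fun_prop
  have hθk' : ∀ k s, deriv (θk k) s = deriv θ (((k : ℝ) + 1) * s) := by
    intro k s
    have h0 := ((hθ.differentiable (by simp)) (((k : ℝ) + 1) * s)).hasDerivAt
    have h1 := (h0.comp s ((hasDerivAt_id s).const_mul ((k : ℝ) + 1))).const_mul ((k : ℝ) + 1)⁻¹
    refine h1.deriv.trans ?_
    have : (k : ℝ) + 1 ≠ 0 := by positivity
    field_simp
  have hθkA : ∀ k s, ‖θk k s‖ ≤ ((k : ℝ) + 1)⁻¹ * A := fun k s => by
    rw [hθk_def, norm_mul, Real.norm_of_nonneg (by positivity : 0 ≤ ((k : ℝ) + 1)⁻¹)]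
    gcongr
    exact hA _
  have hlt : ∀ k : ℕ, ((k : ℝ) + 1)⁻¹ ≤ 1 := fun k => inv_le_one_of_one_le₀ (by simp)
  have hθkA1 : ∀ k s, ‖θk k s‖ ≤ A := fun k s =>
    (hθkA k s).trans (mul_le_of_le_one_left hA0 (hlt k))
  have hinv : Tendsto (fun k : ℕ => ((k : ℝ) + 1)⁻¹ * A) atTop (𝓝 0) := by
    have : Tendsto (fun k : ℕ => ((k : ℝ) + 1)⁻¹) atTop (𝓝 0) := by
      simpa using tendsto_one_div_add_atTop_nhds_zero_nat (𝕜 := ℝ)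
    simpa using this.mul_const A
  have hθklim : ∀ s, Tendsto (fun k => θk k s) atTop (𝓝 0) := fun s =>
    squeeze_zero_norm (fun k => hθkA k s) hinv
  have hθk'lim : ∀ s, s ≠ 0 → Tendsto (fun k => deriv (θk k) s) atTop (𝓝 0) := by
    intro s hs
    simp only [hθk']
    obtain ⟨R, hR⟩ := hθc.deriv.isCompact.isBounded.subset_closedBall 0
    refine tendsto_const_nhds.congr' ?_
    have hbig : Tendsto (fun k : ℕ => ((k : ℝ) + 1) * |s|) atTop atTop :=
      (tendsto_atTop_add_const_right _ 1 tendsto_natCast_atTop_atTop).atTop_mul_const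
        (abs_pos.2 hs)
    filter_upwards [hbig.eventually_gt_atTop R] with k hk
    symm
    refine image_eq_zero_of_notMem_tsupport fun hmem => ?_
    have := hR hmem
    rw [mem_closedBall_zero_iff, norm_mul, Real.norm_of_nonneg (by positivity),
      Real.norm_eq_abs] at this
    linarith
  have hcomp : ∀ k, ContDiff ℝ ∞ fun x => θk k (ρ x) := fun k => (hθk k).comp hρ
  have hgr : ∀ k x, gradient (fun y => h y - c y * θk k (ρ y)) x =
      gradient h x - (c x • deriv (θk k) (ρ x) • gradient ρ x + θk k (ρ x) • gradient c x) := by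
    intro k x
    rw [gradient_sub (differentiableAt_of_smooth hh)
      (differentiableAt_of_smooth (hc.mul (hcomp k))),
      gradient_mul (differentiableAt_of_smooth hc) (differentiableAt_of_smooth (hcomp k)),
      gradient_comp ((hθk k).differentiable (by simp) _) (differentiableAt_of_smooth hρ)]
  have hmem : ∀ k, (fun y => h y - c y * θk k (ρ y)) ∈ classA (posSet w) := by
    intro k
    refine ⟨hh.sub (hc.mul (hcomp k)), hhc.sub hcc.mul_right, fun x hx η hη => ?_⟩
    rw [hgr]
    by_cases hxh : x ∈ tsupport h
    · have hxU := hhU hxh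
      have hρx := eq_zero_of_mem_frontier hw.isOpen hU hρ.continuous hUρ hxU hx
      have hk0 : θk k 0 = 0 := by simp [hθk_def, hθ0]
      have hk1 : deriv (θk k) 0 = 1 := by rw [hθk', mul_zero, hθ']
      rw [hρx, hk0, hk1, one_smul, zero_smul, add_zero]
      refine hη.inner_eq_zero_of_orthogonal hU (hρ.differentiable (by simp)) hUρ hxU hρx
        (hU0 x hxU) ?_
      have hne : ‖gradient ρ x‖ ≠ 0 := norm_ne_zero_iff.2 (hU0 x hxU)
      rw [inner_sub_right, real_inner_smul_right, real_inner_self_eq_norm_sq, hc_def,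
        real_inner_comm]
      field_simp
      ring
    · simp [gradient_eq_zero_of_notMem_tsupport hxh, hc0 x hxh,
        gradient_eq_zero_of_notMem_tsupport fun hxc => hxh (hcsub hxc)]
  have hhm : MemLp h 2 (muW w) := memLp_of_compactSupport hh.continuous hhc
  have hghm : MemLp (gradient h) 2 (muW w) :=
    memLp_of_compactSupport hgh.continuous (hasCompactSupport_gradient hhc)
  refine ⟨hhm, hghm, _, hmem, ?_, ?_⟩
  · refine tendsto_eLpNorm_two_of_dominated (b := fun _ => B * A) (fun k => ?_) (memLp_const _)
      (fun k => .of_forall fun x => ?_) (.of_forall fun x => ?_)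
    · exact ((hmem k).1.continuous.sub hh.continuous).aestronglyMeasurable
    · rw [sub_sub_cancel_left, norm_neg, norm_mul]
      exact mul_le_mul (hB x) (hθkA1 k _) (norm_nonneg _) hB0
    · have := ((hθklim (ρ x)).const_mul (c x)).neg
      simpa using this
  · refine tendsto_eLpNorm_two_of_dominated (b := fun _ => A' * B'' + A * B') (fun k => ?_)
      (memLp_const _) (fun k => .of_forall fun x => ?_) ?_
    · exact ((continuous_gradient (hmem k).1).sub hgh.continuous).aestronglyMeasurable
    · rw [hgr, sub_sub_cancel_left, norm_neg]
      refine (norm_add_le _ _).trans (add_le_add ?_ ?_)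
      · rw [smul_comm, norm_smul, hθk']
        exact mul_le_mul (hA' _) (hB'' x) (norm_nonneg _) ((norm_nonneg _).trans (hA' 0))
      · rw [norm_smul]
        exact mul_le_mul (hθkA1 k _) (hB' x) (norm_nonneg _) hA0
    · filter_upwards [hw.ae_mem_posSet] with x hx
      simp only [hgr, sub_sub_cancel_left]
      have h2 := (hθklim (ρ x)).smul_const (gradient c x)
      have h1 : Tendsto (fun k => c x • deriv (θk k) (ρ x) • gradient ρ x) atTop (𝓝 0) := by
        by_cases hxh : x ∈ tsupport h
        · have hne : ρ x ≠ 0 := ne_of_lt ((hUρ x (hhU hxh)).1 hx)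
          simpa using ((hθk'lim _ hne).smul_const (gradient ρ x)).const_smul (c x)
        · simp [hc0 x hxh]
      simpa using (h1.add h2).neg

/-- A smooth partition of unity localizes membership of test functions in the Sobolev space. -/
lemma memSobolevA_of_local [IsProbabilityMeasure (muW w)]
    (hloc : ∀ x : E n, ∃ U : Set (E n), IsOpen U ∧ x ∈ U ∧ ∀ h : E n → ℝ, ContDiff ℝ ∞ h →
      HasCompactSupport h → tsupport h ⊆ U → MemSobolevA w h (gradient h))
    {h : E n → ℝ} (hh : ContDiff ℝ ∞ h) (hhc : HasCompactSupport h) :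
    MemSobolevA w h (gradient h) := by
  classical
  choose U hU hxU hP using hloc
  obtain ⟨f, hf⟩ := SmoothPartitionOfUnity.exists_isSubordinate (modelWithCornersSelf ℝ (E n))
    (isClosed_univ (X := E n)) U hU (fun x _ => Set.mem_iUnion.2 ⟨x, hxU x⟩)
  have hfin : {i | (Function.support (f i) ∩ tsupport h).Nonempty}.Finite :=
    f.locallyFinite.finite_nonempty_inter_compact hhc.isCompact
  set s := hfin.toFinset with hs
  have hfs : ∀ i, ContDiff ℝ ∞ (f i) := fun i => (f i).contMDiff.contDiff
  have hsum : ∀ x, ∑ i ∈ s, f i x * h x = h x := by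
    intro x
    by_cases hx : x ∈ tsupport h
    · have h1 := f.sum_eq_one (Set.mem_univ x)
      rw [finsum_eq_sum_of_support_subset (s := s)] at h1
      · rw [← Finset.sum_mul, h1, one_mul]
      · intro i hi
        simp only [hs, Set.Finite.coe_toFinset]
        exact ⟨x, hi, hx⟩
    · simp [image_eq_zero_of_notMem_tsupport hx]
  have hmem := MemSobolevA.sum (w := w) s (f := fun i x => f i x * h x)
    (g := fun i => gradient fun x => f i x * h x) fun i _ =>
    hP i _ ((hfs i).mul hh) hhc.mul_left ((tsupport_mul_subset_left).trans (hf i))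
  have hg : (fun x => ∑ i ∈ s, gradient (fun x => f i x * h x) x) = gradient h := by
    ext1 x
    rw [← gradient_sum s fun i _ => differentiableAt_of_smooth ((hfs i).mul hh)]
    simp only [hsum]
  rwa [hg, funext hsum] at hmem

lemma memSobolevA_one_of_smoothBoundary (hw : IsAdmissible w)
    (hS : HasSmoothBoundary (posSet w)) : MemSobolevA w (fun _ => 1) (fun _ => 0) := by
  have := hw.isProbabilityMeasure
  obtain ⟨χ, hχ, hχc, hχ0, -⟩ := exists_radial_cutoff n
  refine .one_of_cutoff hχ hχc hχ0 fun k => memSobolevA_of_local (fun x => ?_) (by fun_prop)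
    (hχc.comp_smul (by positivity))
  by_cases hx : x ∈ frontier (posSet w)
  · obtain ⟨ρ, hρ, hρx, hev⟩ := hS x hx
    have hev2 : ∀ᶠ y in 𝓝 x, gradient ρ y ≠ 0 :=
      (continuous_gradient hρ).continuousAt.eventually_ne hρx
    obtain ⟨U, hUsub, hU, hxU⟩ := mem_nhds_iff.1 (hev.and hev2)
    exact ⟨U, hU, hxU, fun h hh hhc hhU => memSobolevA_of_tsupport_subset hw hU hρ
      (fun y hy => (hUsub hy).1) (fun y hy => (hUsub hy).2) hh hhc hhU⟩
  · refine ⟨(frontier (posSet w))ᶜ, isClosed_frontier.isOpen_compl, hx, fun h hh hhc hhU =>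
      .of_mem_classA ⟨hh, hhc, fun y hy η _ => ?_⟩⟩
    rw [gradient_eq_zero_of_notMem_tsupport fun hyh => hhU hyh hy, inner_zero_left]

end WeightedGaussian

/-! ### Logarithmic Sobolev inequality and its extremals -/

theorem theorem1p8 (n : ℕ) (hn : 0 < n) (w : E n → ℝ)
    (hw_nonneg : ∀ x, 0 ≤ w x)
    (hne : (posSet w).Nonempty) (hopen : IsOpen (posSet w)) (hconv : Convex ℝ (posSet w))
    (hw : ContDiffOn ℝ 2 w (posSet w))
    (hstar : ∃ K : ℝ, -1 < K ∧ HessBound w K) :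
    IsProbabilityMeasure (muW w) ∧
    -- the tight logarithmic Sobolev inequality
    (∀ (f : E n → ℝ) (g : E n → E n), MemSobolevA w f g →
      Integrable (fun x => f x ^ 2 * Real.log (f x ^ 2)) (muW w) ∧
      Ent (muW w) (fun x => f x ^ 2) ≤ 2 / (1 + Kw w) * ∫ x, ‖g x‖ ^ 2 ∂(muW w)) ∧
    -- the exponentials, when `w` does not depend on the `i`-th coordinate
    (∀ i : Fin n, IndepOfCoord w i → Kw w ≤ 0 ∧ ∀ (b : ℝ) (f : E n → ℝ),
      f = (fun x => Real.exp (b * x i)) →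
      (Kw w = 0 →
        Ent (muW w) (fun x => f x ^ 2) =
          2 / (1 + Kw w) * ∫ x, ‖gradient f x‖ ^ 2 ∂(muW w)) ∧
      Ent (muW w) (fun x => f x ^ 2) = 2 * ∫ x, ‖gradient f x‖ ^ 2 ∂(muW w) ∧
      (b ≠ 0 → 0 < ∫ x, ‖gradient f x‖ ^ 2 ∂(muW w)) ∧
      (MemSobolevA w (fun _ => 1) (fun _ => 0) → MemSobolevA w f (gradient f))) ∧
    -- the constants lie in the Sobolev space
    (IsCone (posSet w) ∨ HasSmoothBoundary (posSet w) →
      MemSobolevA w (fun _ => 1) (fun _ => 0)) := by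
  have hadm : IsAdmissible w := ⟨hw_nonneg, hne, hopen, hconv, hw, hstar⟩
  obtain ⟨K, hK1, hK⟩ := hstar
  have hgreat := isGreatest_Kw hn w hne ⟨K, hK⟩
  refine ⟨hadm.isProbabilityMeasure, fun f g hfg =>
    hadm.entropy_le (hK1.trans_le (hgreat.2 hK)) hgreat.1 hfg, fun i hi =>
    ⟨Kw_le_zero_of_indep hadm hi, ?_⟩, ?_⟩
  · rintro b f rfl
    have hent := ent_exp_coord hadm hi b
    refine ⟨fun h0 => by rw [hent, h0, add_zero, div_one], hent, fun hb => ?_,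
      fun h => memSobolevA_exp_coord hadm hi h b⟩
    rw [integral_norm_gradient_exp hadm hi]
    positivity
  · rintro (hS | hS)
    · exact memSobolevA_one_of_isCone hadm hS
    · exact memSobolevA_one_of_smoothBoundary hadm hS
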